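/- **Mechanisms and privacy.** A dataset is $D=(x_1,\dots,x_N)$ with $x_n\in\mathbb R^d$, $\|x_n\|_2\le 1$; $D,D'$ are adjacent if their Hamming distance is $1$. A mechanism $M$ is $(\varepsilon,\delta)$-differentially private if $\Pr[M(D)\in S]\le e^{\varepsilon}\Pr[M(D')\in S]+\delta$ for all adjacent $D,D'$ and all measurable $S$. For a mechanism $M(a,D)$ with an auxiliary input $a$ (the earlier outputs) and $\ell>0$ put $$MA_M(\ell)=\sup_{a}\ \sup_{D,D'\text{ adjacent}}\ \log \mathbb E_{z\sim M(a,D)}\left[\left(\frac{dM(a,D)}{dM(a,D')}(z)\right)^{\ell}\right],$$ the expectation being $+\infty$ if $M(a,D)\not\ll M(a,D')$. For $C>0$ let $\psi_C(v)=v/\max(1,\|v\|_2/C)$ (Frobenius norm for matrices). **P3GM.** Let $\sigma_p,\sigma_e,\sigma_s>0$, $C,C_\pi,C_\mu,C_\Sigma>0$, integers $1\le B\le N$, learning rates $\eta_t\in\mathbb R$, a fixed centre $\mu_X\in\mathbb R^d$ and fixed initial values $\lambda_0,\theta_0$ be given. All noises below are independent. P3GM runs three phases. 1. *DP-PCA.*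 It computes $\hat A=A+E$, where $A=\frac1N\sum_n(x_n-\bar x)(x_n-\bar x)^{\mathsf T}$, $\bar x=\frac1N\sum_n x_n$, and $E$ is symmetric with entries on and above the diagonal i.i.d. $\mathcal N(0,\sigma_p^2)$. With $W=W(\hat A)\in\mathbb R^{d\times d'}$ having as columns orthonormal eigenvectors of $\hat A$ for its $d'$ largest eigenvalues (chosen measurably), put $\hat x_n=W^{\mathsf T}(x_n-\mu_X)$. 2. *DP-EM, $T_e$ steps.* The state is $\lambda=(\pi_k,\mu_k,\Sigma_k)_{k\le K}$, the parameters of a mixture of $K$ Gaussians on $\mathbb R^{d'}$. One step computes from $\lambda$ and $\hat x_1,\dots,\hat x_N$ the usual EM (maximum likelihood) update, clips the weight vector by $\psi_{C_\pi}$, each mean by $\psi_{C_\mu}$ and each covariance matrix by $\psi_{C_\Sigma}$, and adds Gaussian noise to each of these $2K+1$ blocks, with standard deviation $\sigma_e$ times the sensitivity bound $2C_\pi$, $2C_\mu$, $2C_\Sigma$ per coordinate, respectively (for a covariance matrix: a symmetric noise matrix with independent entries on and above the diagonal). 3. *DP-SGD, $T_s$ steps.* The state is $\theta\in\mathbb R^p$,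 the parameters of a Gaussian encoder $q_\theta(z|x)=\mathcal N(\hat x,\operatorname{diag}v_\theta(x))$ and a Gaussian decoder $p_\theta(x|z)$ with mean and diagonal variance given by arbitrary networks. One step draws a batch $S\subseteq\{1,\dots,N\}$ from a fixed law with $\Pr[n\in S]=B/N$ for every $n$, forms $\tilde g=\frac1B\big(\sum_{b\in S}\psi_C(g_b)+\mathcal N(0,\sigma_s^2C^2I)\big)$, where $$g_b=\nabla_\theta\Big[\tfrac1L\sum_{l=1}^L\log p_\theta(x_b|z_{b,l})+\log\sum_{k}\pi_k\exp\big(-D_{\mathrm{KL}}(q_\theta(z|x_b)\,\|\,\mathcal N(\mu_k,\Sigma_k))\big)\Big],\qquad z_{b,l}=\hat x_b+\sqrt{v_\theta(x_b)}\,\xi_{b,l},$$ with $\xi_{b,l}$ i.i.d. standard Gaussian (the gradient is assumed to be a measurable function of its arguments), and sets $\theta\leftarrow\theta-\eta_t\tilde g$. The output is the final $(\theta,\lambda)$. Let $MA_{\text{DP-EM}}$ be the moment $MA$ of one DP-EM step (from $D$ to the noisy $\lambda$, with auxiliary input $\hat A$ and the current $\lambda$), and $MA_{\text{DP-SGD}}$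 that of one DP-SGD step (from $D$ to $\tilde g$, with auxiliary input $\hat A$, the released $\lambda$ and the current $\theta$). **Theorem.** For all $T_e,T_s\ge 0$, $0<\delta<1$ and $\alpha>1$, the moments $MA_{\text{DP-EM}}(\alpha-1)$ and $MA_{\text{DP-SGD}}(\alpha-1)$ are not $+\infty$, and P3GM satisfies $(\varepsilon,\delta)$-differential privacy with $$\varepsilon=\frac{\alpha}{2\sigma_p^2}+T_s\,\frac{MA_{\text{DP-SGD}}(\alpha-1)}{\alpha-1}+T_e\,\frac{MA_{\text{DP-EM}}(\alpha-1)}{\alpha-1}+\frac{\log(1/\delta)}{\alpha-1}.$$ (If there are no adjacent datasets, which happens only for $d=0$, the claim is empty and the moments are read as $0$.) -/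

import Mathlib

open MeasureTheory ProbabilityTheory
open scoped ENNReal NNReal

noncomputable section

namespace P3GM

/-! ### Differential privacy and the moments accountant -/

open Classical in
/-- Two datasets of `N` records are adjacent if their Hamming distance is one. -/
def Adjacent {N : ℕ} {X : Type*} (D D' : Fin N → X) : Prop :=
  hammingDist D D' = 1

/-- `(ε, δ)`-differential privacy of a randomized mechanism, given by its output laws. -/
def IsDP {N : ℕ} {X Z : Type*} [MeasurableSpace Z]
    (M : (Fin N → X) → Measure Z) (ε δ : ℝ) : Prop :=
  ∀ D D' : Fin N → X, Adjacent D D' → ∀ S : Set Z, MeasurableSet S →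
    M D S ≤ ENNReal.ofReal (Real.exp ε) * M D' S + ENNReal.ofReal δ

open Classical in
/-- `E_{z ∼ P} exp (l * log (dP/dQ z)) = E_{z ∼ P} (dP/dQ z) ^ l` for `l > 0`; it is infinite if
`P` is not absolutely continuous with respect to `Q`. -/
def lossMoment {Z : Type*} [MeasurableSpace Z] (l : ℝ) (P Q : Measure Z) : ℝ≥0∞ :=
  if P ≪ Q then ∫⁻ z, (P.rnDeriv Q z) ^ l ∂P else ⊤

/-- The `l`-th moment `MA_M(l)` of a mechanism `M` that also receives an auxiliary input (the
outputs released before): the supremum of the log moments of the privacy loss over all auxiliary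
inputs and all adjacent datasets. -/
def MA {N : ℕ} {Aux X Z : Type*} [MeasurableSpace Z]
    (M : Aux → (Fin N → X) → Measure Z) (l : ℝ) : EReal :=
  ⨆ (a : Aux) (D : Fin N → X) (D' : Fin N → X) (_ : Adjacent D D'),
    ENNReal.log (lossMoment l (M a D) (M a D'))

/-! ### Vectors, clipping, Gaussian noise -/

/-- Euclidean norm (on `ι = Fin m × Fin m`: the Frobenius norm). -/
def l2norm {ι : Type*} [Fintype ι] (v : ι → ℝ) : ℝ := ‖WithLp.toLp 2 v‖

/-- Norm clipping `ψ_C(v) = v / max(1, ‖v‖₂ / C)`. -/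
def clip {ι : Type*} [Fintype ι] (C : ℝ) (v : ι → ℝ) : ι → ℝ :=
  (max 1 (l2norm v / C))⁻¹ • v

/-- `N(0, σ² I)` on `ι → ℝ`. -/
def gaussianNoise (ι : Type*) [Fintype ι] (σ : ℝ) : Measure (ι → ℝ) :=
  Measure.pi fun _ => gaussianReal 0 (Real.toNNReal (σ ^ 2))

/-- The symmetric matrix whose entries on and above the diagonal are listed by `e`. -/
def symm {n : ℕ} (e : Sym2 (Fin n) → ℝ) : Fin n → Fin n → ℝ := fun i j => e s(i, j)

/-- Data records: vectors of Euclidean norm at most one. -/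
abbrev Rec (d : ℕ) := {x : Fin d → ℝ // l2norm x ≤ 1}

/-! ### Differentially private PCA -/

/-- The mean of the records. -/
def mean {N d : ℕ} (D : Fin N → Rec d) : Fin d → ℝ :=
  fun j => (∑ n, (D n).1 j) / N

/-- The covariance matrix of the records. -/
def covariance {N d : ℕ} (D : Fin N → Rec d) : Fin d → Fin d → ℝ :=
  fun i j => (∑ n, ((D n).1 i - mean D i) * ((D n).1 j - mean D j)) / N

/-- DP-PCA releases `A + E`, with `A` the covariance matrix and `E` a symmetric matrix whose
entries on and above the diagonal are i.i.d. `N(0, σ²)`. -/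
def dpPCA {N d : ℕ} (σ : ℝ) (D : Fin N → Rec d) : Measure (Fin d → Fin d → ℝ) :=
  (gaussianNoise (Sym2 (Fin d)) σ).map fun e => covariance D + symm e

/-- The columns of `W` are `m` orthonormal eigenvectors of `S` for its `m` largest eigenvalues. -/
def IsPrincipal {d m : ℕ} (S : Matrix (Fin d) (Fin d) ℝ) (W : Matrix (Fin d) (Fin m) ℝ) : Prop :=
  W.transpose * W = 1 ∧
  ∃ ev : Fin m → ℝ, S * W = W * Matrix.diagonal ev ∧
    ∀ v : Fin d → ℝ, W.transpose.mulVec v = 0 → ∀ j, v ⬝ᵥ S.mulVec v ≤ ev j * (v ⬝ᵥ v)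

/-- Coordinates of `x - c` along the columns of `W`. -/
def reduce {d m : ℕ} (W : Fin d → Fin m → ℝ) (c x : Fin d → ℝ) : Fin m → ℝ :=
  fun j => ∑ i, W i j * (x i - c i)

/-! ### Mixtures of Gaussians and the EM update -/

/-- Parameters `(π, μ, Σ)` of a mixture of `K` Gaussians in dimension `m`. -/
abbrev MoG (K m : ℕ) :=
  (Fin K → ℝ) × (Fin K → Fin m → ℝ) × (Fin K → Fin m → Fin m → ℝ)

/-- `(z - μ)ᵀ Σ⁻¹ (z - μ)`. -/
def mahalanobis {m : ℕ} (μ : Fin m → ℝ) (S : Fin m → Fin m → ℝ) (z : Fin m → ℝ) : ℝ :=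
  (z - μ) ⬝ᵥ (Matrix.of S)⁻¹.mulVec (z - μ)

/-- Density of `N(μ, Σ)` at `z`. -/
def gaussianDensity {m : ℕ} (μ : Fin m → ℝ) (S : Fin m → Fin m → ℝ) (z : Fin m → ℝ) : ℝ :=
  Real.exp (-(mahalanobis μ S z) / 2) /
    Real.sqrt ((2 * Real.pi) ^ m * (Matrix.of S).det)

/-- E step: the responsibility of component `k` for the point `z`. -/
def resp {K m : ℕ} (lam : MoG K m) (z : Fin m → ℝ) (k : Fin K) : ℝ :=
  lam.1 k * gaussianDensity (lam.2.1 k) (lam.2.2 k) z /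
    ∑ j, lam.1 j * gaussianDensity (lam.2.1 j) (lam.2.2 j) z

/-- Total responsibility of component `k`. -/
def respSum {N K m : ℕ} (lam : MoG K m) (z : Fin N → Fin m → ℝ) (k : Fin K) : ℝ :=
  ∑ n, resp lam (z n) k

/-- M step: maximum likelihood estimate of the weights. -/
def mleWeight {N K m : ℕ} (lam : MoG K m) (z : Fin N → Fin m → ℝ) : Fin K → ℝ :=
  fun k => respSum lam z k / N

/-- M step: maximum likelihood estimate of the mean of component `k`. -/
def mleMean {N K m : ℕ} (lam : MoG K m) (z : Fin N → Fin m → ℝ) (k : Fin K) : Fin m → ℝ :=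
  fun i => (∑ n, resp lam (z n) k * z n i) / respSum lam z k

/-- M step: maximum likelihood estimate of the covariance of component `k`. -/
def mleCov {N K m : ℕ} (lam : MoG K m) (z : Fin N → Fin m → ℝ) (k : Fin K) :
    Fin m → Fin m → ℝ :=
  fun i j => (∑ n, resp lam (z n) k *
    ((z n i - mleMean lam z k i) * (z n j - mleMean lam z k j))) / respSum lam z k

/-- The EM update, with each of its `2K + 1` blocks clipped; `C = (C_π, C_μ, C_Σ)`. -/
def emUpdate {N K m : ℕ} (C : ℝ × ℝ × ℝ) (lam : MoG K m) (z : Fin N → Fin m → ℝ) : MoG K m :=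
  (clip C.1 (mleWeight lam z),
   fun k => clip C.2.1 (mleMean lam z k),
   fun k => Function.curry (clip C.2.2 (Function.uncurry (mleCov lam z k))))

/-- The noise of one DP-EM step. A block clipped at `C` has sensitivity (at most) `2C`; its noise
is `σ` times that. The noise of a covariance block is symmetric. -/
def emNoise (K m : ℕ) (C : ℝ × ℝ × ℝ) (σ : ℝ) : Measure (MoG K m) :=
  (gaussianNoise (Fin K) (2 * C.1 * σ)).prod
    ((Measure.pi fun _ : Fin K => gaussianNoise (Fin m) (2 * C.2.1 * σ)).prod
      (Measure.pi fun _ : Fin K => (gaussianNoise (Sym2 (Fin m)) (2 * C.2.2 * σ)).map symm))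

/-! ### The training objective -/

/-- KL divergence from `N(z, diag v)` to `N(μ, Σ)`. -/
def klGaussian {m : ℕ} (z v : Fin m → ℝ) (μ : Fin m → ℝ) (S : Fin m → Fin m → ℝ) : ℝ :=
  (((Matrix.of S)⁻¹ * Matrix.diagonal v).trace + mahalanobis μ S z - m
    + Real.log (Matrix.of S).det - ∑ i, Real.log (v i)) / 2

/-- The approximation `- log ∑_k π_k exp (- KL(N(z, diag v) ‖ N(μ_k, Σ_k)))` of the KL divergence
from `N(z, diag v)` to the mixture. -/
def klMoG {K m : ℕ} (z v : Fin m → ℝ) (lam : MoG K m) : ℝ :=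
  -Real.log (∑ k, lam.1 k * Real.exp (-klGaussian z v (lam.2.1 k) (lam.2.2 k)))

/-- Log-density of `N(μ, diag v)` at `x`. -/
def logGaussian {d : ℕ} (μ v x : Fin d → ℝ) : ℝ :=
  -(∑ i, ((x i - μ i) ^ 2 / v i + Real.log (2 * Real.pi * v i))) / 2

/-- The gradient of a function of `θ`, as the vector of its partial derivatives. -/
def grad {p : ℕ} (f : (Fin p → ℝ) → ℝ) (θ : Fin p → ℝ) : Fin p → ℝ :=
  fun j => fderiv ℝ f θ (Pi.single j 1)

/-! ### The pipeline -/

/-- The hyperparameters, networks and initial values of P3GM, for `N` records in dimension `d`,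
reduced dimension `m`, `p` trained parameters, `K` mixture components and `L` Monte Carlo samples
per gradient. -/
structure Config (N d m p K L : ℕ) where
  /-- noise scales of DP-PCA, DP-EM and DP-SGD -/
  σp : ℝ
  σe : ℝ
  σs : ℝ
  /-- principal component analysis: the `m` leading eigenvectors, as columns -/
  pca : (Fin d → Fin d → ℝ) → Fin d → Fin m → ℝ
  /-- the centre used in the dimensional reduction -/
  center : Fin d → ℝ
  /-- clipping sizes of the weights, means and covariances in DP-EM -/
  clipEM : ℝ × ℝ × ℝ
  /-- initial mixture parameters -/
  lam₀ : MoG K m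
  /-- variance network of the encoder; its mean is the reduced record -/
  encVar : (Fin p → ℝ) → (Fin d → ℝ) → Fin m → ℝ
  /-- mean and variance networks of the decoder -/
  decMean : (Fin p → ℝ) → (Fin m → ℝ) → Fin d → ℝ
  decVar : (Fin p → ℝ) → (Fin m → ℝ) → Fin d → ℝ
  /-- initial network parameters -/
  θ₀ : Fin p → ℝ
  /-- batch size and law of the random batch -/
  B : ℕ
  batch : PMF (Finset (Fin N))
  /-- gradient norm bound and learning rates -/
  C : ℝ
  η : ℕ → ℝ

namespace Config

variable {N d m p K L : ℕ} (c : Config N d m p K L)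

/-- Reduction of a record by means of the released matrix `A`. -/
def enc (A : Fin d → Fin d → ℝ) (x : Rec d) : Fin m → ℝ := reduce (c.pca A) c.center x.1

/-- The Monte Carlo evidence lower bound at a record `x` with reduced record `z` and prior
`MoG(lam)`; `ξ` holds the standard Gaussian samples of the reparametrization
`z_l = z + √var · ξ_l`. -/
def elbo (θ : Fin p → ℝ) (x : Fin d → ℝ) (z : Fin m → ℝ) (lam : MoG K m)
    (ξ : Fin L → Fin m → ℝ) : ℝ :=
  (∑ l, logGaussian
      (c.decMean θ (fun i => z i + Real.sqrt (c.encVar θ x i) * ξ l i))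
      (c.decVar θ (fun i => z i + Real.sqrt (c.encVar θ x i) * ξ l i)) x) / L
    - klMoG z (c.encVar θ x) lam

/-- The gradient of the evidence lower bound in the network parameters. -/
def elboGrad (θ : Fin p → ℝ) (x : Fin d → ℝ) (z : Fin m → ℝ) (lam : MoG K m)
    (ξ : Fin L → Fin m → ℝ) : Fin p → ℝ :=
  grad (fun θ' => c.elbo θ' x z lam ξ) θ

/-- One DP-EM step. Auxiliary input: the output of DP-PCA and the current mixture. -/
def emStep (a : (Fin d → Fin d → ℝ) × MoG K m) (D : Fin N → Rec d) : Measure (MoG K m) :=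
  (emNoise K m c.clipEM c.σe).map fun Y =>
    emUpdate c.clipEM a.2 (fun n => c.enc a.1 (D n)) + Y

/-- One DP-SGD step: the law of the noisy average gradient
`B⁻¹ (∑_{b ∈ batch} ψ_C(g_b) + N(0, σ_s² C² I))`. Auxiliary input: the output of DP-PCA, the
mixture released by DP-EM and the current network parameters. -/
def sgdStep (a : (Fin d → Fin d → ℝ) × MoG K m × (Fin p → ℝ)) (D : Fin N → Rec d) :
    Measure (Fin p → ℝ) :=
  ∑ S : Finset (Fin N), c.batch S •
    ((Measure.pi fun _ : Fin N => Measure.pi fun _ : Fin L => gaussianNoise (Fin m) 1).prod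
      (gaussianNoise (Fin p) (c.σs * c.C))).map fun w =>
        (c.B : ℝ)⁻¹ •
          ((∑ b ∈ S, clip c.C (c.elboGrad a.2.2 (D b).1 (c.enc a.1 (D b)) a.2.1 (w.1 b))) + w.2)

/-- Law of the mixture after `t` steps of DP-EM. -/
def dpEM (A : Fin d → Fin d → ℝ) (D : Fin N → Rec d) : ℕ → Measure (MoG K m)
  | 0 => Measure.dirac c.lam₀
  | t + 1 => (dpEM A D t).bind fun lam => c.emStep (A, lam) D

/-- Law of the network parameters after `t` steps of DP-SGD, `θ_{t+1} = θ_t - η_t g_t`. -/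
def dpSGD (A : Fin d → Fin d → ℝ) (lam : MoG K m) (D : Fin N → Rec d) :
    ℕ → Measure (Fin p → ℝ)
  | 0 => Measure.dirac c.θ₀
  | t + 1 => (dpSGD A lam D t).bind fun θ =>
      (c.sgdStep (A, lam, θ) D).map fun g => θ - c.η t • g

/-- P3GM: DP-PCA, then `Te` steps of DP-EM on the reduced records, then `Ts` steps of DP-SGD. The
output consists of the network parameters and the mixture parameters. -/
def p3gm (Te Ts : ℕ) (D : Fin N → Rec d) : Measure ((Fin p → ℝ) × MoG K m) :=
  (dpPCA c.σp D).bind fun A =>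
    (c.dpEM A D Te).bind fun lam =>
      (c.dpSGD A lam D Ts).map fun θ => (θ, lam)

end Config

end P3GM

end

namespace P3GM

/-! ### Dual form of the moment bound -/

/-! Rényi differential privacy composes adaptively. Write $\beta=\alpha/(\alpha-1)$. If $\int
f\,dP\le K\,(\int f^{\beta}\,dQ)^{1/\beta}$ for all $f\ge 0$, the best $K$ is $(\int
(dP/dQ)^{\alpha}dQ)^{1/\alpha}=\exp\big(\frac{\alpha-1}{\alpha}D_\alpha(P\|Q)\big)$. The argument
works with this inequality instead of densities: post-processing (`RenyiBound.map`) is a change of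
variables, adaptive composition (`RenyiBound.bind`) is the inequality applied twice, and mixtures
with common weights (`RenyiBound.sum`) are Jensen. No density of a composed mechanism has to be
chosen measurably in the earlier outputs.

Each phase supplies a constant. For DP-PCA, `sum_covariance_sub_sq_le` bounds the $\ell^2$
sensitivity of the covariance by 1, so the Gaussian shift bound `renyiBound_gaussianNoise` gives
$\exp((\alpha-1)/(2\sigma_p^2))$. For DP-EM and DP-SGD a crude bound from clipping shows that the
moments are finite (`MA_ne_top`); the moment itself then gives $\exp(MA/\alpha)$ per step
(`renyiBound_of_MA`), which is where the duality with `lossMoment` is used. The constants multiply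
along the pipeline (`renyiBound_p3gm`), and `apply_le_exp_mul_add` turns the product into
$(\varepsilon,\delta)$-privacy by testing with indicators. -/

/-- A Hölder-type bound of `P` against `Q`; it is the dual form of
`∫ (dP/dQ)^α dQ ≤ K^α`, see `RenyiBound.of_lossMoment_le` and `RenyiBound.lossMoment_le`. -/
def RenyiBound {Z : Type*} [MeasurableSpace Z] (α : ℝ) (K : ℝ≥0∞) (P Q : Measure Z) : Prop :=
  ∀ f : Z → ℝ≥0∞, Measurable f →
    ∫⁻ z, f z ∂P ≤ K * (∫⁻ z, f z ^ (α / (α - 1)) ∂Q) ^ ((α - 1) / α)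

theorem holderConjugate_div_sub_one {α : ℝ} (hα : 1 < α) :
    α.HolderConjugate (α / (α - 1)) := Real.HolderConjugate.conjExponent hα

theorem lintegral_rnDeriv_rpow_sub_one {Z : Type*} [MeasurableSpace Z] {α : ℝ} (hα : 1 < α)
    {P Q : Measure Z} [SigmaFinite P] [SigmaFinite Q] (hPQ : P ≪ Q) :
    ∫⁻ z, P.rnDeriv Q z ^ (α - 1) ∂P = ∫⁻ z, P.rnDeriv Q z ^ α ∂Q := by
  have hm := Measure.measurable_rnDeriv P Q
  rw [← lintegral_rnDeriv_mul hPQ (hm.pow_const _).aemeasurable]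
  refine lintegral_congr fun z => ?_
  conv_lhs => enter [1]; rw [← ENNReal.rpow_one (P.rnDeriv Q z)]
  rw [← ENNReal.rpow_add_of_nonneg _ _ zero_le_one (by linarith)]
  ring_nf

namespace RenyiBound

variable {Y Z : Type*} [MeasurableSpace Y] [MeasurableSpace Z] {α : ℝ} {K K' : ℝ≥0∞}

theorem mono {P Q : Measure Z} (h : RenyiBound α K P Q) (hK : K ≤ K') : RenyiBound α K' P Q :=
  fun f hf => (h f hf).trans (by gcongr)

/-- This is Hölder's inequality for the product of the density and the test function. -/
theorem of_withDensity (hα : 1 < α) {Q : Measure Z} {h : Z → ℝ≥0∞} (hh : Measurable h) :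
    RenyiBound α ((∫⁻ z, h z ^ α ∂Q) ^ (1 / α)) (Q.withDensity h) Q := by
  intro f hf
  rw [lintegral_withDensity_eq_lintegral_mul _ hh hf]
  have := ENNReal.lintegral_mul_le_Lp_mul_Lq Q (holderConjugate_div_sub_one hα)
    hh.aemeasurable hf.aemeasurable
  rwa [one_div_div] at this

theorem refl (hα : 1 < α) (P : Measure Z) [IsProbabilityMeasure P] : RenyiBound α 1 P P := by
  simpa using of_withDensity hα (Q := P) (h := 1) measurable_one

theorem map {P Q : Measure Z} (h : RenyiBound α K P Q) {g : Z → Y} (hg : Measurable g) :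
    RenyiBound α K (P.map g) (Q.map g) := by
  intro f hf
  rw [lintegral_map hf hg, lintegral_map (hf.pow_const _) hg]
  exact h _ (hf.comp hg)

theorem rpow_rpow_conj (hα : 1 < α) (x : ℝ≥0∞) :
    (x ^ ((α - 1) / α)) ^ (α / (α - 1)) = x := by
  have h0 : α ≠ 0 := by linarith
  have h1 : α - 1 ≠ 0 := by linarith
  rw [← ENNReal.rpow_mul, div_mul_div_cancel₀ h0, div_self h1, ENNReal.rpow_one]

/-- Apply the kernel bound inside the integral, then the bound for `P` to the test function
$y\mapsto(\int f^{\beta}\,d\kappa'_y)^{1/\beta}$; the outer power $\beta$ cancels the inner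
$1/\beta$. The kernels are compared at the same `y`, which is why a supremum over auxiliary inputs
suffices for adaptive composition. -/
theorem bind (hα : 1 < α) {P Q : Measure Y} (h : RenyiBound α K P Q) {κ κ' : Y → Measure Z}
    (hκ : Measurable κ) (hκ' : Measurable κ') (h' : ∀ y, RenyiBound α K' (κ y) (κ' y)) :
    RenyiBound α (K * K') (P.bind κ) (Q.bind κ') := by
  intro f hf
  have hfβ := hf.pow_const (α / (α - 1))
  have hm : Measurable fun y => ∫⁻ z, f z ^ (α / (α - 1)) ∂κ' y :=
    (Measure.measurable_lintegral hfβ).comp hκ'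
  rw [Measure.lintegral_bind hκ.aemeasurable hf.aemeasurable,
    Measure.lintegral_bind hκ'.aemeasurable hfβ.aemeasurable]
  calc ∫⁻ y, ∫⁻ z, f z ∂κ y ∂P
      ≤ ∫⁻ y, K' * (∫⁻ z, f z ^ (α / (α - 1)) ∂κ' y) ^ ((α - 1) / α) ∂P :=
        lintegral_mono fun y => h' y f hf
    _ = K' * ∫⁻ y, (∫⁻ z, f z ^ (α / (α - 1)) ∂κ' y) ^ ((α - 1) / α) ∂P :=
        lintegral_const_mul _ (hm.pow_const _)
    _ ≤ K' * (K * (∫⁻ y, ((∫⁻ z, f z ^ (α / (α - 1)) ∂κ' y) ^ ((α - 1) / α)) ^ (α / (α - 1)) ∂Q)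
          ^ ((α - 1) / α)) := by
        gcongr
        exact h _ (hm.pow_const _)
    _ = _ := by
        simp_rw [rpow_rpow_conj hα]
        ring

theorem prod (hα : 1 < α) {P Q : Measure Y} {P' Q' : Measure Z} [SFinite P'] [SFinite Q']
    (h : RenyiBound α K P Q) (h' : RenyiBound α K' P' Q') :
    RenyiBound α (K * K') (P.prod P') (Q.prod Q') := by
  rw [Measure.prod, Measure.prod]
  exact h.bind hα Measurable.map_prodMk_left Measurable.map_prodMk_left
    fun _ => h'.map measurable_prodMk_left

/-- The weights agree on both sides, so concavity of $x\mapsto x^{1/\beta}$ moves the average inside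
the power. It serves the random batch, whose law does not depend on the data. -/
theorem sum (hα : 1 < α) {ι : Type*} {s : Finset ι} {w : ι → ℝ≥0∞} (hw : ∑ i ∈ s, w i = 1)
    {P Q : ι → Measure Z} (h : ∀ i ∈ s, RenyiBound α K (P i) (Q i)) :
    RenyiBound α K (∑ i ∈ s, w i • P i) (∑ i ∈ s, w i • Q i) := by
  intro f hf
  simp only [lintegral_finsetSum_measure, lintegral_smul_measure, smul_eq_mul]
  set J : ι → ℝ≥0∞ := fun i => ∫⁻ z, f z ^ (α / (α - 1)) ∂Q i
  have h0 : 0 < α := by linarith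
  have h1 : 0 < α - 1 := by linarith
  have key : ∑ i ∈ s, w i * J i ^ ((α - 1) / α) ≤ (∑ i ∈ s, w i * J i) ^ ((α - 1) / α) := by
    have := ENNReal.rpow_arith_mean_le_arith_mean_rpow s w (fun i => J i ^ ((α - 1) / α)) hw
      (p := α / (α - 1)) (by rw [le_div_iff₀ h1]; linarith)
    simp_rw [rpow_rpow_conj hα] at this
    have h2 := ENNReal.rpow_le_rpow this (z := (α - 1) / α) (by positivity)
    rwa [← ENNReal.rpow_mul, div_mul_div_cancel₀ h1.ne', div_self h0.ne', ENNReal.rpow_one] at h2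
  calc ∑ i ∈ s, w i * ∫⁻ z, f z ∂P i ≤ ∑ i ∈ s, w i * (K * J i ^ ((α - 1) / α)) :=
        Finset.sum_le_sum fun i hi => by gcongr; exact h i hi f hf
    _ = K * ∑ i ∈ s, w i * J i ^ ((α - 1) / α) := by
        rw [Finset.mul_sum]; exact Finset.sum_congr rfl fun i _ => by ring
    _ ≤ _ := by gcongr

theorem of_lossMoment_le (hα : 1 < α) {P Q : Measure Z} [SigmaFinite P] [SigmaFinite Q]
    {M : ℝ≥0∞} (hM : M ≠ ⊤) (h : lossMoment (α - 1) P Q ≤ M) :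
    RenyiBound α (M ^ (1 / α)) P Q := by
  unfold lossMoment at h
  split_ifs at h with hPQ
  · have h0 : 0 < α := by linarith
    have hm := Measure.measurable_rnDeriv P Q
    have := of_withDensity hα (Q := Q) hm
    rw [Measure.withDensity_rnDeriv_eq P Q hPQ] at this
    refine this.mono ?_
    gcongr
    rwa [lintegral_rnDeriv_rpow_sub_one hα hPQ] at h
  · exact absurd (top_le_iff.1 h) hM

theorem apply_le (hα : 1 < α) {P Q : Measure Z} (h : RenyiBound α K P Q) {s : Set Z}
    (hs : MeasurableSet s) : P s ≤ K * Q s ^ ((α - 1) / α) := by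
  have := h (s.indicator 1) (measurable_one.indicator hs)
  have h0 : 0 < α := by linarith
  have h1 : 0 < α - 1 := by linarith
  have h2 : ∀ z, s.indicator (1 : Z → ℝ≥0∞) z ^ (α / (α - 1)) = s.indicator 1 z := by
    intro z
    by_cases hz : z ∈ s <;> simp [hz, div_pos h0 h1]
  simpa only [h2, lintegral_indicator_one hs] using this

theorem absolutelyContinuous (hα : 1 < α) {P Q : Measure Z} (h : RenyiBound α K P Q) : P ≪ Q := by
  refine Measure.AbsolutelyContinuous.mk fun s hs hQ => ?_
  have := h.apply_le hα hs
  rw [hQ, ENNReal.zero_rpow_of_pos (div_pos (by linarith) (by linarith)), mul_zero] at this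
  simpa using this

/-- Converse of Hölder. The extremal test function is $r^{\alpha-1}$ with $r=dP/dQ$, but its
integral might be infinite, so $r$ is truncated at $n$ and monotone convergence removes the
truncation. -/
theorem lossMoment_le (hα : 1 < α) {P Q : Measure Z} [IsFiniteMeasure P] [SigmaFinite Q]
    (h : RenyiBound α K P Q) : lossMoment (α - 1) P Q ≤ K ^ α := by
  have hPQ := h.absolutelyContinuous hα
  have h0 : 0 < α := by linarith
  have h1 : 0 < α - 1 := by linarith
  have hm := Measure.measurable_rnDeriv P Q
  rw [lossMoment, if_pos hPQ]
  set r := P.rnDeriv Q with hr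
  set g : ℕ → Z → ℝ≥0∞ := fun n z => (min (r z) n) ^ (α - 1) with hg
  have hgm : ∀ n, Measurable (g n) := fun n => (hm.min measurable_const).pow_const _
  have hsup : ∀ z, r z ^ (α - 1) = ⨆ n, g n z := by
    intro z
    have hmono : Monotone fun n : ℕ => min (r z) (n : ℝ≥0∞) :=
      fun a b hab => min_le_min le_rfl (by exact_mod_cast hab)
    have hs : (⨆ n : ℕ, min (r z) (n : ℝ≥0∞)) = r z := by
      rw [← inf_iSup_eq, ENNReal.iSup_natCast, inf_top_eq]
    have := (ENNReal.orderIsoRpow (α - 1) h1).map_iSup fun n : ℕ => min (r z) (n : ℝ≥0∞)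
    rw [hs] at this
    simpa only [ENNReal.orderIsoRpow_apply] using this
  have hstep : ∀ n, ∫⁻ z, g n z ∂P ≤ K ^ α := by
    intro n
    set J := ∫⁻ z, g n z ∂P with hJ
    have hJtop : J ≠ ⊤ := by
      refine ne_top_of_le_ne_top ?_
        (lintegral_mono (g := fun _ => (n : ℝ≥0∞) ^ (α - 1)) fun z => ?_)
      · rw [lintegral_const]
        exact ENNReal.mul_ne_top (ENNReal.rpow_ne_top_of_nonneg h1.le (by simp))
          (measure_ne_top _ _)
      · exact ENNReal.rpow_le_rpow (min_le_right _ _) h1.le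
    -- The integrand is $\min(r,n)^{\alpha}\le r\min(r,n)^{\alpha-1}$, and the factor $r$ turns $Q$
    -- into $P$.
    have h2 : ∫⁻ z, g n z ^ (α / (α - 1)) ∂Q ≤ J := by
      rw [hJ, ← lintegral_rnDeriv_mul hPQ (hgm n).aemeasurable]
      refine lintegral_mono fun z => ?_
      simp only [hg]
      rw [← ENNReal.rpow_mul, mul_div_cancel₀ _ h1.ne']
      calc min (r z) n ^ α = min (r z) n ^ (1 : ℝ) * min (r z) n ^ (α - 1) := by
            rw [← ENNReal.rpow_add_of_nonneg _ _ zero_le_one h1.le]; ring_nf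
        _ ≤ _ := by
            rw [ENNReal.rpow_one]
            gcongr
            exact min_le_left _ _
    have h3 : J ≤ K * J ^ ((α - 1) / α) := by
      refine (h _ (hgm n)).trans ?_
      gcongr
    by_cases hJ0 : J = 0
    · simp [hJ0]
    have h4 : J = J ^ (1 / α) * J ^ ((α - 1) / α) := by
      rw [← ENNReal.rpow_add _ _ hJ0 hJtop, ← add_div, add_sub_cancel, div_self h0.ne',
        ENNReal.rpow_one]
    have hp0 : J ^ ((α - 1) / α) ≠ 0 := by
      simp [hJ0, hJtop]
    have hpt : J ^ ((α - 1) / α) ≠ ⊤ := ENNReal.rpow_ne_top_of_nonneg (by positivity) hJtop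
    -- Dividing `h3` by $J^{1/\beta}$ is legitimate because $J$ is neither 0 nor infinite;
    -- finiteness is what the truncation bought.
    have h5 : J ^ (1 / α) ≤ K := by
      exact (ENNReal.mul_le_mul_iff_left hp0 hpt).1 (h4 ▸ h3)
    calc J = (J ^ (1 / α)) ^ α := by
          rw [← ENNReal.rpow_mul, one_div_mul_cancel h0.ne', ENNReal.rpow_one]
      _ ≤ K ^ α := ENNReal.rpow_le_rpow h5 h0.le
  simp_rw [hsup]
  rw [lintegral_iSup hgm]
  · exact iSup_le hstep
  · intro a b hab z
    exact ENNReal.rpow_le_rpow (min_le_min le_rfl (by exact_mod_cast hab)) h1.le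

/-- The indicator bound reads $P(s)\le y^{1-1/\alpha}$ with $y=e^{\varepsilon}Q(s)$. Below the
threshold $y=\delta^{\alpha/(\alpha-1)}$ this is at most $\delta$; above it,
$y^{-1/\alpha}\le\delta^{-1/(\alpha-1)}$, which is the extra factor $e^{\log(1/\delta)/(\alpha-1)}$.
-/
theorem apply_le_exp_mul_add (hα : 1 < α) {P Q : Measure Z} [IsProbabilityMeasure Q] {ε δ : ℝ}
    (hδ : 0 < δ)
    (h : RenyiBound α (ENNReal.ofReal (Real.exp ((α - 1) / α * ε))) P Q)
    {s : Set Z} (hs : MeasurableSet s) :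
    P s ≤ ENNReal.ofReal (Real.exp (ε + Real.log (1 / δ) / (α - 1))) * Q s
      + ENNReal.ofReal δ := by
  have h0 : 0 < α := by linarith
  have h1 : 0 < α - 1 := by linarith
  refine (h.apply_le hα hs).trans ?_
  set q := (Q s).toReal with hq
  have hQ : Q s = ENNReal.ofReal q := (ENNReal.ofReal_toReal (measure_ne_top _ _)).symm
  have hq0 : 0 ≤ q := ENNReal.toReal_nonneg
  rw [hQ, ENNReal.ofReal_rpow_of_nonneg hq0 (by positivity),
    ← ENNReal.ofReal_mul (Real.exp_nonneg _), ← ENNReal.ofReal_mul (Real.exp_nonneg _),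
    ← ENNReal.ofReal_add (by positivity) hδ.le]
  refine ENNReal.ofReal_le_ofReal ?_
  have e1 : Real.exp ((α - 1) / α * ε) * q ^ ((α - 1) / α)
      = (Real.exp ε * q) ^ ((α - 1) / α) := by
    rw [Real.mul_rpow (Real.exp_nonneg _) hq0, ← Real.exp_mul, mul_comm ε]
  have e2 : Real.exp (ε + Real.log (1 / δ) / (α - 1)) * q
      = (Real.exp ε * q) * δ ^ (-(1 / (α - 1))) := by
    rw [Real.exp_add, Real.rpow_def_of_pos hδ, one_div δ, Real.log_inv]
    ring_nf
  rw [e1, e2]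
  set y := Real.exp ε * q with hy
  have hy0 : 0 ≤ y := by positivity
  have hδp : 0 < δ ^ (α / (α - 1)) := Real.rpow_pos_of_pos hδ _
  rcases le_total y (δ ^ (α / (α - 1))) with hle | hle
  · have : y ^ ((α - 1) / α) ≤ δ := by
      calc y ^ ((α - 1) / α) ≤ (δ ^ (α / (α - 1))) ^ ((α - 1) / α) :=
            Real.rpow_le_rpow hy0 hle (by positivity)
        _ = δ := by
            rw [← Real.rpow_mul hδ.le, div_mul_div_cancel₀ h1.ne', div_self h0.ne', Real.rpow_one]
    have : 0 ≤ y * δ ^ (-(1 / (α - 1))) := by positivity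
    linarith
  · have hypos : 0 < y := hδp.trans_le hle
    have : y ^ ((α - 1) / α) ≤ y * δ ^ (-(1 / (α - 1))) := by
      have e3 : y ^ ((α - 1) / α) = y * y ^ (-(1 / α)) := by
        conv_rhs => enter [1]; rw [← Real.rpow_one y]
        rw [← Real.rpow_add hypos]
        congr 1
        field_simp
        ring
      have e4 : δ ^ (-(1 / (α - 1))) = (δ ^ (α / (α - 1))) ^ (-(1 / α)) := by
        rw [← Real.rpow_mul hδ.le]
        congr 1
        field_simp
      rw [e3, e4]
      gcongr 1
      exact Real.rpow_le_rpow_of_nonpos hδp hle (by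
        rw [neg_nonpos]; positivity)
    linarith

end RenyiBound

/-! ### Products and Gaussian shifts -/

theorem lintegral_pi_prod {ι : Type*} [Fintype ι] {X : ι → Type*} [∀ i, MeasurableSpace (X i)]
    (Q : ∀ i, Measure (X i)) [∀ i, IsProbabilityMeasure (Q i)] {h : ∀ i, X i → ℝ≥0∞}
    (hh : ∀ i, Measurable (h i)) :
    ∫⁻ x, ∏ i, h i (x i) ∂Measure.pi Q = ∏ i, ∫⁻ y, h i y ∂Q i := by
  have := lintegral_prod_eq_prod_lintegral_of_indepFun (μ := Measure.pi Q) Finset.univ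
    (fun i x => h i (x i)) (iIndepFun_pi fun i => (hh i).aemeasurable)
    fun i => (hh i).comp (measurable_pi_apply i)
  refine this.trans ?_
  refine Finset.prod_congr rfl fun i _ => ?_
  exact (measurePreserving_eval Q i).lintegral_comp (hh i)

theorem pi_withDensity {ι : Type*} [Fintype ι] {X : ι → Type*} [∀ i, MeasurableSpace (X i)]
    (Q : ∀ i, Measure (X i)) [∀ i, IsProbabilityMeasure (Q i)] {h : ∀ i, X i → ℝ≥0∞}
    (hh : ∀ i, Measurable (h i)) [∀ i, SigmaFinite ((Q i).withDensity (h i))] :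
    Measure.pi (fun i => (Q i).withDensity (h i))
      = (Measure.pi Q).withDensity fun x => ∏ i, h i (x i) := by
  refine Measure.pi_eq fun s hs => ?_
  rw [withDensity_apply _ (MeasurableSet.univ_pi hs),
    ← lintegral_indicator (MeasurableSet.univ_pi hs)]
  have : ∀ x : ∀ i, X i, (Set.univ.pi s).indicator (fun x => ∏ i, h i (x i)) x
      = ∏ i, (s i).indicator (h i) (x i) := by
    intro x
    by_cases hx : x ∈ Set.univ.pi s
    · rw [Set.indicator_of_mem hx]
      exact Finset.prod_congr rfl fun i _ => (Set.indicator_of_mem (hx i trivial) _).symm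
    · rw [Set.indicator_of_notMem hx]
      simp only [Set.mem_pi, Set.mem_univ, true_imp_iff, not_forall] at hx
      obtain ⟨i, hi⟩ := hx
      exact (Finset.prod_eq_zero (Finset.mem_univ i) (Set.indicator_of_notMem hi _)).symm
  simp_rw [this]
  rw [lintegral_pi_prod Q fun i => (hh i).indicator (hs i)]
  refine Finset.prod_congr rfl fun i _ => ?_
  rw [lintegral_indicator (hs i), withDensity_apply _ (hs i)]

theorem RenyiBound.lintegral_rnDeriv_rpow_le {Z : Type*} [MeasurableSpace Z] {α : ℝ} (hα : 1 < α)
    {K : ℝ≥0∞} {P Q : Measure Z} [IsFiniteMeasure P] [SigmaFinite Q]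
    (h : RenyiBound α K P Q) : (∫⁻ z, P.rnDeriv Q z ^ α ∂Q) ^ (1 / α) ≤ K := by
  have h0 : 0 < α := by linarith
  have hle := h.lossMoment_le hα
  have hPQ := h.absolutelyContinuous hα
  rw [lossMoment, if_pos hPQ, lintegral_rnDeriv_rpow_sub_one hα hPQ] at hle
  calc (∫⁻ z, P.rnDeriv Q z ^ α ∂Q) ^ (1 / α) ≤ (K ^ α) ^ (1 / α) :=
        ENNReal.rpow_le_rpow hle (by positivity)
    _ = K := by rw [← ENNReal.rpow_mul, mul_one_div_cancel h0.ne', ENNReal.rpow_one]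

/-- The dual bounds are turned back into moments of the coordinate densities. The product measure
has the product density, whose $\alpha$-th moment factorizes. -/
theorem RenyiBound.pi {ι : Type*} [Fintype ι] {X : ι → Type*} [∀ i, MeasurableSpace (X i)]
    {α : ℝ} (hα : 1 < α) {K : ι → ℝ≥0∞} {P Q : ∀ i, Measure (X i)}
    [∀ i, IsProbabilityMeasure (P i)] [∀ i, IsProbabilityMeasure (Q i)]
    (h : ∀ i, RenyiBound α (K i) (P i) (Q i)) :
    RenyiBound α (∏ i, K i) (Measure.pi P) (Measure.pi Q) := by
  have h0 : 0 < α := by linarith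
  have hm := fun i => Measure.measurable_rnDeriv (P i) (Q i)
  have hP := fun i => Measure.withDensity_rnDeriv_eq (P i) (Q i) ((h i).absolutelyContinuous hα)
  have : ∀ i, SigmaFinite ((Q i).withDensity ((P i).rnDeriv (Q i))) :=
    fun i => by rw [hP i]; infer_instance
  have hpi := pi_withDensity Q hm
  simp only [hP] at hpi
  rw [hpi]
  refine (of_withDensity hα (Finset.measurable_prod _ fun i _ =>
    (hm i).comp (measurable_pi_apply i))).mono ?_
  simp_rw [← ENNReal.prod_rpow_of_nonneg h0.le, Function.comp_apply]
  rw [lintegral_pi_prod Q fun i => (hm i).pow_const α,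
    ← ENNReal.prod_rpow_of_nonneg (by positivity)]
  exact Finset.prod_le_prod' fun i _ => (h i).lintegral_rnDeriv_rpow_le hα

theorem gaussianReal_eq_withDensity (a b : ℝ) {v : ℝ≥0} (hv : v ≠ 0) :
    gaussianReal a v = (gaussianReal b v).withDensity fun x =>
      ENNReal.ofReal (Real.exp ((a - b) / v * x - (a ^ 2 - b ^ 2) / (2 * v))) := by
  have hv' : (v : ℝ) ≠ 0 := by exact_mod_cast hv
  rw [gaussianReal_of_var_ne_zero _ hv, gaussianReal_of_var_ne_zero _ hv,
    ← withDensity_mul _ (measurable_gaussianPDF _ _) (by fun_prop)]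
  congr 1
  ext x
  simp only [Pi.mul_apply, gaussianPDF, gaussianPDFReal]
  rw [← ENNReal.ofReal_mul (by positivity), mul_assoc (_)⁻¹, ← Real.exp_add]
  congr 3
  field_simp
  ring

/-- The density is an exponential tilt, so its $\alpha$-th moment is a value of the Gaussian moment
generating function, namely $\exp(\alpha(\alpha-1)(a-b)^2/(2v))$. The root $1/\alpha$ removes the
factor $\alpha$. -/
theorem renyiBound_gaussianReal {α : ℝ} (hα : 1 < α) (a b : ℝ) {v : ℝ≥0} (hv : v ≠ 0) :
    RenyiBound α (ENNReal.ofReal (Real.exp ((α - 1) * ((a - b) ^ 2 / (2 * v)))))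
      (gaussianReal a v) (gaussianReal b v) := by
  have h0 : 0 < α := by linarith
  have hv' : (v : ℝ) ≠ 0 := by exact_mod_cast hv
  rw [gaussianReal_eq_withDensity a b hv]
  refine (RenyiBound.of_withDensity hα (by fun_prop)).mono (le_of_eq ?_)
  have e : ∀ x : ℝ, ENNReal.ofReal (Real.exp ((a - b) / v * x - (a ^ 2 - b ^ 2) / (2 * v))) ^ α
      = ENNReal.ofReal (Real.exp (-(α * (a ^ 2 - b ^ 2) / (2 * v)))) *
        ENNReal.ofReal (Real.exp (α * (a - b) / v * x)) := by
    intro x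
    rw [ENNReal.ofReal_rpow_of_pos (Real.exp_pos _), ← Real.exp_mul,
      ← ENNReal.ofReal_mul (Real.exp_nonneg _), ← Real.exp_add]
    congr 2
    ring
  simp_rw [e]
  rw [lintegral_const_mul _ (by fun_prop), ← ofReal_integral_eq_lintegral_ofReal
    (integrable_exp_mul_gaussianReal _) (ae_of_all _ fun _ => Real.exp_nonneg _)]
  have := congrFun (mgf_fun_id_gaussianReal (μ := b) (v := v)) (α * (a - b) / v)
  rw [mgf] at this
  rw [this, ← ENNReal.ofReal_mul (Real.exp_nonneg _), ← Real.exp_add,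
    ENNReal.ofReal_rpow_of_pos (Real.exp_pos _), ← Real.exp_mul]
  congr 2
  field_simp
  ring

instance isProbabilityMeasure_gaussianNoise (ι : Type*) [Fintype ι] (σ : ℝ) :
    IsProbabilityMeasure (gaussianNoise ι σ) := by
  unfold gaussianNoise; infer_instance

theorem gaussianNoise_map_add {ι : Type*} [Fintype ι] (σ : ℝ) (s : ι → ℝ) :
    (gaussianNoise ι σ).map (fun e => s + e)
      = Measure.pi fun i => gaussianReal (s i) (Real.toNNReal (σ ^ 2)) := by
  have := Measure.pi_map_pi (μ := fun _ : ι => gaussianReal 0 (Real.toNNReal (σ ^ 2)))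
    (f := fun i x => s i + x) (hμ := fun i => by rw [gaussianReal_map_const_add]; infer_instance)
    fun i => by fun_prop
  simp only [gaussianReal_map_const_add, zero_add] at this
  exact this

theorem renyiBound_gaussianNoise {ι : Type*} [Fintype ι] {α : ℝ} (hα : 1 < α) {σ : ℝ}
    (hσ : 0 < σ) (s s' : ι → ℝ) {R : ℝ} (hR : ∑ i, (s i - s' i) ^ 2 ≤ R) :
    RenyiBound α (ENNReal.ofReal (Real.exp ((α - 1) * (R / (2 * σ ^ 2)))))
      ((gaussianNoise ι σ).map (fun e => s + e)) ((gaussianNoise ι σ).map (fun e => s' + e)) := by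
  have hv : Real.toNNReal (σ ^ 2) ≠ 0 := by simpa using hσ.ne'
  have hv' : ((Real.toNNReal (σ ^ 2) : ℝ≥0) : ℝ) = σ ^ 2 := Real.coe_toNNReal _ (by positivity)
  have h1 : 0 < α - 1 := by linarith
  rw [gaussianNoise_map_add, gaussianNoise_map_add]
  refine (RenyiBound.pi hα
    fun i => renyiBound_gaussianReal hα (s i) (s' i) hv).mono ?_
  rw [← ENNReal.ofReal_prod_of_nonneg fun _ _ => Real.exp_nonneg _, ← Real.exp_sum, hv',
    ← Finset.mul_sum, ← Finset.sum_div]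
  gcongr

/-! ### Sensitivity of the covariance matrix -/

/-- Scalar form of `norm_pow_four_add_sub_le`: `X, Y, t` are the Gram entries of two sides of a
triangle. The case analysis is on the position of an angle that is not acute; in an acute triangle
`hR` says that the circumradius is at most one. -/
theorem gram_pow_four_le {X Y t : ℝ} (hX0 : 0 ≤ X) (hY0 : 0 ≤ Y) (hX : X ≤ 4) (hY : Y ≤ 4)
    (hZ : X + Y - 2 * t ≤ 4) (hG : t ^ 2 ≤ X * Y)
    (hR : 0 ≤ t → t ≤ X → t ≤ Y → t ^ 2 < X * Y →
      X * Y * (X + Y - 2 * t) ≤ 4 * (X * Y - t ^ 2)) :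
    X ^ 2 + Y ^ 2 - 2 * t ^ 2 ≤ 16 := by
  rcases lt_or_ge t 0 with ht | ht
  · nlinarith
  rcases lt_or_ge X t with h1 | h1
  · nlinarith
  rcases lt_or_ge Y t with h2 | h2
  · nlinarith
  rcases hG.eq_or_lt with h3 | h3
  · nlinarith
  have hR := hR ht h1 h2 h3
  set G := X * Y - t ^ 2 with hGdef
  have hGpos : 0 < G := by linarith
  have hXY : 0 < X * Y := lt_of_le_of_lt (sq_nonneg t) h3
  set Z := X + Y - 2 * t with hZdef
  have hZ0 : 0 ≤ Z := by linarith
  -- The difference of the two sides is exactly twice the square in the hint.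
  have key : (X ^ 2 + Y ^ 2 - 2 * t ^ 2) * G ≤ Z ^ 2 * (X * Y + t ^ 2) := by
    rw [hGdef, hZdef]
    nlinarith [sq_nonneg ((X + Y) * t - (X * Y + t ^ 2))]
  have h4 : (X * Y * Z) ^ 2 ≤ (4 * G) ^ 2 := pow_le_pow_left₀ (by positivity) hR 2
  have h5 : (X * Y) ^ 2 * ((X ^ 2 + Y ^ 2 - 2 * t ^ 2) * G) ≤ (X * Y) ^ 2 * (16 * G) := by
    calc (X * Y) ^ 2 * ((X ^ 2 + Y ^ 2 - 2 * t ^ 2) * G)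
        ≤ (X * Y) ^ 2 * (Z ^ 2 * (X * Y + t ^ 2)) := by gcongr
      _ = (X * Y * Z) ^ 2 * (X * Y + t ^ 2) := by ring
      _ ≤ (4 * G) ^ 2 * (X * Y + t ^ 2) := by gcongr
      _ = 16 * G * ((X * Y) ^ 2 - t ^ 4) := by rw [hGdef]; ring
      _ ≤ 16 * G * (X * Y) ^ 2 := by
          gcongr
          linarith [show 0 ≤ t ^ 4 by positivity]
      _ = _ := by ring
  exact le_of_mul_le_mul_right (le_of_mul_le_mul_left h5 (by positivity)) hGpos

/-- The left side is $\|uu^{\mathsf T}-vv^{\mathsf T}\|_F^2$. What remains for `gram_pow_four_le` is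
that an acute triangle in the unit ball has circumradius at most 1. Its circumcentre $o$ is a convex
combination of the vertices, and the average of $\|\cdot\|^2$ over the vertices with these weights
is $R^2+\|o\|^2$, hence $R^2\le 1$. -/
theorem norm_pow_four_add_sub_le {E : Type*} [NormedAddCommGroup E] [InnerProductSpace ℝ E]
    {x y m : E} (hx : ‖x‖ ≤ 1) (hy : ‖y‖ ≤ 1) (hm : ‖m‖ ≤ 1) :
    (‖x - m‖ ^ 2) ^ 2 + (‖y - m‖ ^ 2) ^ 2 - 2 * (inner ℝ (x - m) (y - m)) ^ 2 ≤ 16 := by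
  set u := x - m with hu
  set v := y - m with hv
  have hX : ‖u‖ ≤ 2 := (norm_sub_le _ _).trans (by linarith)
  have hY : ‖v‖ ≤ 2 := (norm_sub_le _ _).trans (by linarith)
  have hZ : ‖u - v‖ ≤ 2 := by
    rw [hu, hv, sub_sub_sub_cancel_right]
    exact (norm_sub_le _ _).trans (by linarith)
  have hxu : ‖u + m‖ ≤ 1 := by rw [hu, sub_add_cancel]; exact hx
  have hyv : ‖v + m‖ ≤ 1 := by rw [hv, sub_add_cancel]; exact hy
  have hZ2 : ‖u - v‖ ^ 2 ≤ 4 := by nlinarith [norm_nonneg (u - v)]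
  have hx2 : ‖u + m‖ ^ 2 ≤ 1 := by nlinarith [norm_nonneg (u + m)]
  have hy2 : ‖v + m‖ ^ 2 ≤ 1 := by nlinarith [norm_nonneg (v + m)]
  have hm2 : ‖m‖ ^ 2 ≤ 1 := by nlinarith [norm_nonneg m]
  rw [norm_sub_sq_real] at hZ2
  rw [norm_add_sq_real] at hx2 hy2
  have hCS : (inner ℝ u v) ^ 2 ≤ ‖u‖ ^ 2 * ‖v‖ ^ 2 := by
    rw [← mul_pow, sq_le_sq, abs_of_nonneg (by positivity : 0 ≤ ‖u‖ * ‖v‖)]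
    exact abs_real_inner_le_norm u v
  refine gram_pow_four_le (by positivity) (by positivity) (by nlinarith [norm_nonneg u])
    (by nlinarith [norm_nonneg v]) (by linarith) hCS ?_
  intro h0 h1 h2 h3
  set X := ‖u‖ ^ 2
  set Y := ‖v‖ ^ 2
  set t : ℝ := inner ℝ u v
  set p : ℝ := inner ℝ u m
  set q : ℝ := inner ℝ v m
  set w := ‖m‖ ^ 2
  have hY0 : 0 ≤ Y := sq_nonneg _
  have hX0 : 0 ≤ X := sq_nonneg _
  set G := X * Y - t ^ 2 with hG
  have hGpos : 0 < G := by linarith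
  -- The vector is $2G\,o$. The barycentric weights of `x`, `y`, `m`, scaled to sum $2G$, are
  -- $Y(X-t)$, $X(Y-t)$ and $t(X+Y-2t)$; `a1`, `a2` and `a3` below use them in that order.
  have hc : 0 ≤ ‖(2 * G) • m + ((Y * (X - t)) • u + (X * (Y - t)) • v)‖ ^ 2 := sq_nonneg _
  have e : ‖(2 * G) • m + ((Y * (X - t)) • u + (X * (Y - t)) • v)‖ ^ 2
      = G * (4 * G * w + 4 * (Y * (X - t) * p + X * (Y - t) * q)
        + X * Y * (X + Y - 2 * t)) := by
    rw [norm_add_sq_real, norm_add_sq_real]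
    simp only [norm_smul, inner_add_right, inner_smul_left, inner_smul_right, mul_pow,
      Real.norm_eq_abs, sq_abs, conj_trivial]
    rw [real_inner_comm u m, real_inner_comm v m]
    change (2 ^ 2 * G ^ 2) * w + 2 * (Y * (X - t) * (2 * G * p) + X * (Y - t) * (2 * G * q))
      + (Y ^ 2 * (X - t) ^ 2 * X + 2 * (X * (Y - t) * (Y * (X - t) * t))
        + X ^ 2 * (Y - t) ^ 2 * Y) = _
    rw [hG]
    ring
  rw [e] at hc
  have hc' := nonneg_of_mul_nonneg_right hc hGpos
  have a1 := mul_le_mul_of_nonneg_left hx2 (mul_nonneg hY0 (sub_nonneg.2 h1))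
  have a2 := mul_le_mul_of_nonneg_left hy2 (mul_nonneg hX0 (sub_nonneg.2 h2))
  have a3 := mul_le_mul_of_nonneg_left hm2 (mul_nonneg h0 (show 0 ≤ X + Y - 2 * t by linarith))
  nlinarith

theorem l2norm_sq {ι : Type*} [Fintype ι] (v : ι → ℝ) : l2norm v ^ 2 = ∑ i, v i ^ 2 := by
  rw [l2norm, EuclideanSpace.norm_sq_eq]
  simp

theorem sum_outer_sub_sq {ι : Type*} [Fintype ι] (u v : ι → ℝ) :
    ∑ i, ∑ j, (u i * u j - v i * v j) ^ 2
      = (∑ i, u i ^ 2) ^ 2 + (∑ i, v i ^ 2) ^ 2 - 2 * (∑ i, u i * v i) ^ 2 := by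
  have : ∀ i j, (u i * u j - v i * v j) ^ 2
      = u i ^ 2 * u j ^ 2 + v i ^ 2 * v j ^ 2 - 2 * ((u i * v i) * (u j * v j)) := by
    intro i j; ring
  simp_rw [this, Finset.sum_sub_distrib, Finset.sum_add_distrib, ← Finset.mul_sum,
    ← Finset.sum_mul]
  ring

theorem sum_outer_sub_sq_le {ι : Type*} [Fintype ι] {x y m : ι → ℝ} (hx : l2norm x ≤ 1)
    (hy : l2norm y ≤ 1) (hm : l2norm m ≤ 1) :
    ∑ i, ∑ j, ((x i - m i) * (x j - m j) - (y i - m i) * (y j - m j)) ^ 2 ≤ 16 := by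
  have h := norm_pow_four_add_sub_le hx hy hm
  rw [← WithLp.toLp_sub, ← WithLp.toLp_sub] at h
  have e1 := l2norm_sq (x - m)
  have e2 := l2norm_sq (y - m)
  rw [l2norm] at e1 e2
  rw [e1, e2] at h
  have e3 : inner ℝ (WithLp.toLp 2 (x - m)) (WithLp.toLp 2 (y - m))
      = ∑ i, (x i - m i) * (y i - m i) := by
    simp [PiLp.inner_apply, mul_comm]
  rw [e3] at h
  rw [sum_outer_sub_sq (fun i => x i - m i) fun i => y i - m i]
  exact h

/-- `Quot.out` picks one ordered pair for each unordered one, so the triangular sum is part of the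
full sum. -/
theorem sum_sym2_le {ι : Type*} [Fintype ι] [DecidableEq ι] (g : Sym2 ι → ℝ)
    (hg : ∀ q, 0 ≤ g q) : ∑ q, g q ≤ ∑ i, ∑ j, g s(i, j) := by
  rw [← Fintype.sum_prod_type' fun i j => g s(i, j)]
  have hinj : Function.Injective (Quot.out : Sym2 ι → ι × ι) :=
    Function.LeftInverse.injective Quot.out_eq
  calc ∑ q, g q = ∑ r ∈ Finset.univ.map ⟨Quot.out, hinj⟩, g s(r.1, r.2) := by
        rw [Finset.sum_map]
        refine Finset.sum_congr rfl fun q _ => ?_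
        exact congrArg g (Quot.out_eq q).symm
    _ ≤ _ := Finset.sum_le_sum_of_subset_of_nonneg (Finset.subset_univ _) fun r _ _ => hg _

theorem Adjacent.exists_forall_ne {N : ℕ} {X : Type*} {D D' : Fin N → X} (h : Adjacent D D') :
    ∃ a, ∀ n, n ≠ a → D n = D' n := by
  classical
  have h' : (Finset.univ.filter fun i => D i ≠ D' i).card = 1 := by
    unfold Adjacent hammingDist at h
    convert h
  obtain ⟨a, ha⟩ := Finset.card_eq_one.1 h'
  refine ⟨a, fun n hn => ?_⟩
  by_contra hne
  have : n ∈ Finset.univ.filter fun i => D i ≠ D' i := by simpa using hne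
  rw [ha, Finset.mem_singleton] at this
  exact hn this

theorem covariance_eq {N d : ℕ} (hN : 0 < N) (D : Fin N → Rec d) (i j : Fin d) :
    covariance D i j = (∑ n, (D n).1 i * (D n).1 j) / N
      - (∑ n, (D n).1 i) / N * ((∑ n, (D n).1 j) / N) := by
  have hN' : (N : ℝ) ≠ 0 := by exact_mod_cast hN.ne'
  have : ∀ n, ((D n).1 i - mean D i) * ((D n).1 j - mean D j)
      = (D n).1 i * (D n).1 j - mean D i * (D n).1 j - mean D j * (D n).1 i
        + mean D i * mean D j := by
    intro n; ring
  simp_rw [covariance, this, Finset.sum_add_distrib, Finset.sum_sub_distrib, ← Finset.mul_sum,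
    Finset.sum_const, Finset.card_univ, Fintype.card_fin, nsmul_eq_mul, mean]
  field_simp
  ring

theorem covariance_symm {N d : ℕ} (D : Fin N → Rec d) (i j : Fin d) :
    covariance D i j = covariance D j i := by
  simp only [covariance, mul_comm]

/-- Replacing the record `a` changes the covariance matrix by a multiple of
`(x - m)(x - m)ᵀ - (x' - m)(x' - m)ᵀ`, with `m` the mean of the other records. -/
theorem covariance_sub {N d : ℕ} (hN : 0 < N) {D D' : Fin N → Rec d} {a : Fin N}
    (h : ∀ n, n ≠ a → D n = D' n) {m : Fin d → ℝ}
    (hm : ∀ i, (N - 1 : ℝ) * m i = ∑ n ∈ Finset.univ.erase a, (D n).1 i) (i j : Fin d) :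
    covariance D i j - covariance D' i j = (N - 1 : ℝ) / N ^ 2 *
      (((D a).1 i - m i) * ((D a).1 j - m j) - ((D' a).1 i - m i) * ((D' a).1 j - m j)) := by
  have hN' : (N : ℝ) ≠ 0 := by exact_mod_cast hN.ne'
  have hs : ∀ f : Rec d → ℝ, ∑ n, f (D n) = f (D a) + ∑ n ∈ Finset.univ.erase a, f (D n) :=
    fun f => (Finset.add_sum_erase _ (fun n => f (D n)) (Finset.mem_univ a)).symm
  have hs' : ∀ f : Rec d → ℝ, ∑ n, f (D' n) = f (D' a) + ∑ n ∈ Finset.univ.erase a, f (D n) := by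
    intro f
    rw [← Finset.add_sum_erase _ (fun n => f (D' n)) (Finset.mem_univ a)]
    congr 1
    exact Finset.sum_congr rfl fun n hn => by rw [h n (Finset.ne_of_mem_erase hn)]
  rw [covariance_eq hN, covariance_eq hN, hs fun x => x.1 i * x.1 j, hs fun x => x.1 i,
    hs fun x => x.1 j, hs' fun x => x.1 i * x.1 j, hs' fun x => x.1 i, hs' fun x => x.1 j,
    ← hm i, ← hm j]
  field_simp
  ring

theorem exists_mean_erase {N d : ℕ} (D : Fin N → Rec d) (a : Fin N) :
    ∃ m : Fin d → ℝ, l2norm m ≤ 1 ∧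
      ∀ i, (N - 1 : ℝ) * m i = ∑ n ∈ Finset.univ.erase a, (D n).1 i := by
  have hcard : ((Finset.univ.erase a).card : ℝ) = N - 1 := by
    rw [Finset.card_erase_of_mem (Finset.mem_univ a), Finset.card_univ, Fintype.card_fin,
      Nat.cast_pred (Fin.pos a)]
  refine ⟨fun i => (N - 1 : ℝ)⁻¹ * ∑ n ∈ Finset.univ.erase a, (D n).1 i, ?_, fun i => ?_⟩
  · have e : WithLp.toLp 2 (fun i => (N - 1 : ℝ)⁻¹ * ∑ n ∈ Finset.univ.erase a, (D n).1 i)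
        = (N - 1 : ℝ)⁻¹ • ∑ n ∈ Finset.univ.erase a, WithLp.toLp 2 (D n).1 := by
      ext i
      simp
    have hnn : 0 ≤ (N - 1 : ℝ) := by rw [← hcard]; positivity
    rw [l2norm, e, norm_smul, norm_inv, Real.norm_of_nonneg hnn]
    calc (N - 1 : ℝ)⁻¹ * ‖∑ n ∈ Finset.univ.erase a, WithLp.toLp 2 (D n).1‖
        ≤ (N - 1 : ℝ)⁻¹ * ∑ n ∈ Finset.univ.erase a, (1 : ℝ) := by
          gcongr
          exact norm_sum_le_of_le _ fun n _ => (D n).2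
      _ = (N - 1 : ℝ)⁻¹ * (N - 1) := by simp only [Finset.sum_const, nsmul_eq_mul, hcard, mul_one]
      _ ≤ 1 := inv_mul_le_one
  -- With a single record there are no others: `m` is the zero vector since the inverse of 0 is 0,
  -- and both sides vanish.
  · by_cases h : (N - 1 : ℝ) = 0
    · rw [h] at hcard
      have : Finset.univ.erase a = ∅ := by
        rw [← Finset.card_eq_zero]; exact_mod_cast hcard
      simp [this, h]
    · rw [mul_inv_cancel_left₀ h]

/-- The `ℓ²` sensitivity of the covariance matrix, in its entries on and above the diagonal, is at
most one. -/
theorem sum_covariance_sub_sq_le {N d : ℕ} {D D' : Fin N → Rec d} (h : Adjacent D D') :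
    ∑ q : Sym2 (Fin d), (Sym2.lift ⟨covariance D, covariance_symm D⟩ q
      - Sym2.lift ⟨covariance D', covariance_symm D'⟩ q) ^ 2 ≤ 1 := by
  obtain ⟨a, ha⟩ := h.exists_forall_ne
  obtain ⟨m, hm1, hm⟩ := exists_mean_erase D a
  have hN : 0 < N := Fin.pos a
  refine (sum_sym2_le _ fun q => sq_nonneg _).trans ?_
  simp only [Sym2.lift_mk]
  simp_rw [covariance_sub hN ha hm, mul_pow _ _ 2, ← Finset.mul_sum]
  have hN' : (0 : ℝ) < N := by exact_mod_cast hN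
  have hN1 : (1 : ℝ) ≤ N := by exact_mod_cast hN
  -- The factor $(N-1)/N^2$ is largest at $N=2$, which is $(N-2)^2\ge 0$. Its square $1/16$
  -- compensates the 16 of `sum_outer_sub_sq_le`.
  have hc : ((N - 1 : ℝ) / N ^ 2) ^ 2 ≤ (1 / 4) ^ 2 := by
    refine pow_le_pow_left₀ (div_nonneg (by linarith) (by positivity)) ?_ 2
    rw [div_le_div_iff₀ (by positivity) (by norm_num)]
    nlinarith [sq_nonneg ((N : ℝ) - 2)]
  calc _ ≤ (1 / 4 : ℝ) ^ 2 * 16 :=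
        mul_le_mul hc (sum_outer_sub_sq_le (D a).2 (D' a).2 hm1)
          (Finset.sum_nonneg fun i _ => Finset.sum_nonneg fun j _ => sq_nonneg _) (by positivity)
    _ = 1 := by norm_num

/-! ### Parametrized measures -/

section Param

variable {Y Z W : Type*} [MeasurableSpace Y] [MeasurableSpace Z] [MeasurableSpace W]

/-- Composition formulas for `Measure.bind` require measurable kernels, so every stage of the
pipeline must depend measurably on the earlier outputs. This lemma carries the inductions over the
steps. -/
theorem measurable_bind_param {κ : Y → Measure Z} (hκ : Measurable κ)
    (hp : ∀ y, IsProbabilityMeasure (κ y)) {η : Y → Z → Measure W}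
    (hη : Measurable fun r : Y × Z => η r.1 r.2) :
    Measurable fun y => (κ y).bind (η y) := by
  refine Measure.measurable_of_measurable_coe _ fun s hs => ?_
  let k : Kernel Y Z := ⟨κ, hκ⟩
  have : IsMarkovKernel k := ⟨hp⟩
  have e : ∀ y, (κ y).bind (η y) s = ∫⁻ z, η y z s ∂k y := fun y =>
    Measure.bind_apply hs (hη.comp measurable_prodMk_left).aemeasurable
  simp_rw [e]
  exact Measurable.lintegral_kernel_prod_right ((Measure.measurable_coe hs).comp hη)

theorem measurable_map_param {κ : Y → Measure Z} (hκ : Measurable κ)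
    (hp : ∀ y, IsProbabilityMeasure (κ y)) {f : Y → Z → W}
    (hf : Measurable fun r : Y × Z => f r.1 r.2) :
    Measurable fun y => (κ y).map (f y) := by
  have e : ∀ y, (κ y).map (f y) = (κ y).bind fun z => Measure.dirac (f y z) := fun y =>
    (Measure.bind_dirac_eq_map _ (hf.comp measurable_prodMk_left)).symm
  simp_rw [e]
  exact measurable_bind_param hκ hp (Measure.measurable_dirac.comp hf)

theorem prod_map_eq_bind (μ : Measure Y) (ν : Measure Z) [SFinite ν] {f : Y → Z → W}
    (hf : Measurable fun r : Y × Z => f r.1 r.2)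
    (hm : Measurable fun y => ν.map (f y)) :
    (μ.prod ν).map (fun r => f r.1 r.2) = μ.bind fun y => ν.map (f y) := by
  ext s hs
  rw [Measure.map_apply hf hs, Measure.prod_apply (hf hs), Measure.bind_apply hs hm.aemeasurable]
  refine lintegral_congr fun y => ?_
  exact (Measure.map_apply (hf.comp measurable_prodMk_left) hs).symm

theorem measurable_sum_smul {ι : Type*} (s : Finset ι) (w : ι → ℝ≥0∞) {κ : ι → Y → Measure Z}
    (hκ : ∀ i, Measurable (κ i)) : Measurable fun y => ∑ i ∈ s, w i • κ i y := by
  refine Measure.measurable_of_measurable_coe _ fun t ht => ?_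
  simp only [Measure.coe_finsetSum, Finset.sum_apply, Measure.smul_apply, smul_eq_mul]
  exact Finset.measurable_sum _ fun i _ =>
    ((Measure.measurable_coe ht).comp (hκ i)).const_mul _

end Param

/-! ### Moments -/

section Moments

variable {N : ℕ} {Aux X Z : Type*} [MeasurableSpace Z] {M : Aux → (Fin N → X) → Measure Z}
  {α : ℝ}

/-- The constant `K` has to be uniform in the auxiliary input, since the moment is a supremum over
it. -/
theorem MA_ne_top (hα : 1 < α) (hM : ∀ a D, IsProbabilityMeasure (M a D)) {K : ℝ≥0∞} (hK : K ≠ ⊤)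
    (h : ∀ a D D', RenyiBound α K (M a D) (M a D')) : MA M (α - 1) ≠ ⊤ := by
  have hle : MA M (α - 1) ≤ ENNReal.log (K ^ α) := by
    refine iSup_le fun a => iSup_le fun D => iSup_le fun D' => iSup_le fun _ => ?_
    exact ENNReal.log_le_log ((h a D D').lossMoment_le hα)
  refine ne_top_of_le_ne_top ?_ hle
  rw [Ne, ENNReal.log_eq_top_iff]
  exact ENNReal.rpow_ne_top_of_nonneg (by linarith) hK

theorem renyiBound_of_MA (hα : 1 < α) (hM : ∀ a D, IsProbabilityMeasure (M a D))
    (hMA : MA M (α - 1) ≠ ⊤) (a : Aux) {D D' : Fin N → X} (hD : Adjacent D D') :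
    RenyiBound α (ENNReal.ofReal (Real.exp ((MA M (α - 1)).toReal / α))) (M a D) (M a D') := by
  have h1 : ENNReal.log (lossMoment (α - 1) (M a D) (M a D')) ≤ MA M (α - 1) :=
    le_iSup_of_le a (le_iSup_of_le D (le_iSup_of_le D' (le_iSup_of_le hD le_rfl)))
  have h2 : lossMoment (α - 1) (M a D) (M a D')
      ≤ ENNReal.ofReal (Real.exp (MA M (α - 1)).toReal) := by
    -- Only an upper bound is needed, so `toReal` sending `⊥` to 0 does no harm.
    have := EReal.exp_monotone (h1.trans (EReal.le_coe_toReal hMA))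
    rwa [ENNReal.exp_log, EReal.exp_coe] at this
  have h3 := RenyiBound.of_lossMoment_le hα ENNReal.ofReal_ne_top h2
  rwa [ENNReal.ofReal_rpow_of_pos (Real.exp_pos _), ← Real.exp_mul, mul_one_div] at h3

end Moments

/-! ### Clipping -/

theorem l2norm_clip_le {ι : Type*} [Fintype ι] {C : ℝ} (hC : 0 < C) (v : ι → ℝ) :
    l2norm (clip C v) ≤ C := by
  have h0 : 0 < max 1 (l2norm v / C) := lt_max_of_lt_left one_pos
  have : l2norm (clip C v) = (max 1 (l2norm v / C))⁻¹ * l2norm v := by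
    rw [l2norm, clip, WithLp.toLp_smul, norm_smul, norm_inv, Real.norm_of_nonneg h0.le]
    rfl
  rw [this, inv_mul_le_iff₀ h0, ← div_le_iff₀ hC]
  exact le_max_right _ _

theorem sum_sub_sq_le {ι : Type*} [Fintype ι] {R : ℝ} {v w : ι → ℝ} (hv : l2norm v ≤ R)
    (hw : l2norm w ≤ R) : ∑ i, (v i - w i) ^ 2 ≤ (2 * R) ^ 2 := by
  have e := l2norm_sq (v - w)
  simp only [Pi.sub_apply] at e
  rw [← e]
  refine pow_le_pow_left₀ (norm_nonneg _) ?_ 2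
  have : l2norm (v - w) ≤ l2norm v + l2norm w := by
    rw [l2norm, WithLp.toLp_sub]
    exact norm_sub_le _ _
  change l2norm (v - w) ≤ _
  linarith

theorem measurable_l2norm {ι : Type*} [Fintype ι] : Measurable (l2norm : (ι → ℝ) → ℝ) := by
  have : (l2norm : (ι → ℝ) → ℝ) = fun v => Real.sqrt (∑ i, v i ^ 2) := by
    ext v
    rw [← l2norm_sq, Real.sqrt_sq]
    exact norm_nonneg _
  rw [this]
  fun_prop

theorem measurable_clip {ι : Type*} [Fintype ι] (C : ℝ) :
    Measurable (clip C : (ι → ℝ) → ι → ℝ) := by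
  have := measurable_l2norm (ι := ι)
  unfold clip
  fun_prop

/-! ### Measurability of the EM update -/

section EM

variable {Y : Type*} [MeasurableSpace Y]

theorem measurable_det {ι : Type*} [Fintype ι] [DecidableEq ι] {A : Y → Matrix ι ι ℝ}
    (hA : ∀ i j, Measurable fun y => A y i j) : Measurable fun y => (A y).det := by
  simp only [Matrix.det_apply']
  exact Finset.measurable_sum _ fun σ _ =>
    (Finset.measurable_prod _ fun i _ => hA _ _).const_mul _

/-- The formula $\det(A)^{-1}\operatorname{adj}(A)$ also gives the value 0 assigned to singular
matrices, so no case distinction is needed. -/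
theorem measurable_matrix_inv_apply {ι : Type*} [Fintype ι] [DecidableEq ι] {A : Y → Matrix ι ι ℝ}
    (hA : ∀ i j, Measurable fun y => A y i j) (i j : ι) :
    Measurable fun y => (A y)⁻¹ i j := by
  simp only [Matrix.inv_def, Matrix.smul_apply, smul_eq_mul, Ring.inverse_eq_inv,
    Matrix.adjugate_apply]
  refine (measurable_det hA).inv.mul (measurable_det fun k l => ?_)
  simp only [Matrix.updateRow_apply]
  split_ifs
  · exact measurable_const
  · exact hA k l

theorem measurable_mahalanobis {m : ℕ} : Measurable
    fun r : (Fin m → ℝ) × (Fin m → Fin m → ℝ) × (Fin m → ℝ) => mahalanobis r.1 r.2.1 r.2.2 := by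
  have h : ∀ i j, Measurable fun r : (Fin m → ℝ) × (Fin m → Fin m → ℝ) × (Fin m → ℝ) =>
      (Matrix.of r.2.1)⁻¹ i j := measurable_matrix_inv_apply fun i j => by
    exact (measurable_pi_apply j).comp
      ((measurable_pi_apply i).comp (measurable_fst.comp measurable_snd))
  have hd : ∀ i, Measurable fun r : (Fin m → ℝ) × (Fin m → Fin m → ℝ) × (Fin m → ℝ) =>
      r.2.2 i - r.1 i := fun i =>
    ((measurable_pi_apply i).comp (measurable_snd.comp measurable_snd)).sub
      ((measurable_pi_apply i).comp measurable_fst)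
  simp only [mahalanobis, dotProduct, Matrix.mulVec, Pi.sub_apply]
  exact Finset.measurable_sum _ fun i _ => (hd i).mul
    (Finset.measurable_sum _ fun j _ => (h i j).mul (hd j))

theorem measurable_gaussianDensity {m : ℕ} : Measurable
    fun r : (Fin m → ℝ) × (Fin m → Fin m → ℝ) × (Fin m → ℝ) =>
      gaussianDensity r.1 r.2.1 r.2.2 := by
  have h := measurable_mahalanobis (m := m)
  have h' : Measurable fun r : (Fin m → ℝ) × (Fin m → Fin m → ℝ) × (Fin m → ℝ) =>
      (Matrix.of r.2.1).det := measurable_det fun i j => by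
    exact (measurable_pi_apply j).comp
      ((measurable_pi_apply i).comp (measurable_fst.comp measurable_snd))
  unfold gaussianDensity
  exact (h.neg.div_const 2).exp.div (h'.const_mul _).sqrt

theorem measurable_resp {K m : ℕ} (k : Fin K) :
    Measurable fun r : MoG K m × (Fin m → ℝ) => resp r.1 r.2 k := by
  have h : ∀ j : Fin K, Measurable fun r : MoG K m × (Fin m → ℝ) =>
      r.1.1 j * gaussianDensity (r.1.2.1 j) (r.1.2.2 j) r.2 := fun j => by
    have hs : Measurable fun r : MoG K m × (Fin m → ℝ) => r.1.2 :=
      measurable_snd.comp measurable_fst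
    have h1 : Measurable fun r : MoG K m × (Fin m → ℝ) => (r.1.2.1 j, r.1.2.2 j, r.2) :=
      ((measurable_pi_apply j).comp (measurable_fst.comp hs)).prodMk
        (((measurable_pi_apply j).comp (measurable_snd.comp hs)).prodMk measurable_snd)
    have h2 : Measurable fun r : MoG K m × (Fin m → ℝ) => r.1.1 j :=
      (measurable_pi_apply j).comp (measurable_fst.comp measurable_fst)
    have h3 := measurable_gaussianDensity.comp h1
    simp only [Function.comp_def] at h3
    exact h2.mul h3
  exact (h k).div (Finset.measurable_sum _ fun j _ => h j)

theorem measurable_emUpdate {N K m : ℕ} (C : ℝ × ℝ × ℝ) :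
    Measurable fun r : MoG K m × (Fin N → Fin m → ℝ) => emUpdate C r.1 r.2 := by
  have hr : ∀ n k, Measurable fun r : MoG K m × (Fin N → Fin m → ℝ) => resp r.1 (r.2 n) k :=
    fun n k => (measurable_resp k).comp (by fun_prop :
      Measurable fun r : MoG K m × (Fin N → Fin m → ℝ) => (r.1, r.2 n))
  have hs : ∀ k, Measurable fun r : MoG K m × (Fin N → Fin m → ℝ) => respSum r.1 r.2 k :=
    fun k => Finset.measurable_sum _ fun n _ => hr n k
  have hw : Measurable fun r : MoG K m × (Fin N → Fin m → ℝ) => mleWeight r.1 r.2 :=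
    measurable_pi_lambda _ fun k => (hs k).div_const _
  have hm : ∀ k i, Measurable fun r : MoG K m × (Fin N → Fin m → ℝ) => mleMean r.1 r.2 k i :=
    fun k i => by
      refine (Finset.measurable_sum _ fun n _ => (hr n k).mul ?_).div (hs k)
      fun_prop
  have hc : ∀ k i j, Measurable fun r : MoG K m × (Fin N → Fin m → ℝ) =>
      mleCov r.1 r.2 k i j := fun k i j => by
    refine (Finset.measurable_sum _ fun n _ => (hr n k).mul ((Measurable.sub ?_ (hm k i)).mul
      (Measurable.sub ?_ (hm k j)))).div (hs k) <;> fun_prop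
  refine ((measurable_clip _).comp hw).prodMk (Measurable.prodMk ?_ ?_)
  · exact measurable_pi_lambda _ fun k => (measurable_clip _).comp (measurable_pi_lambda _ (hm k))
  · refine measurable_pi_lambda _ fun k => measurable_pi_lambda _ fun i =>
      measurable_pi_lambda _ fun j => ?_
    exact (measurable_pi_apply (i, j)).comp
      ((measurable_clip _).comp (measurable_pi_lambda _ fun q => hc k q.1 q.2))

theorem mleCov_symm {N K m : ℕ} (lam : MoG K m) (z : Fin N → Fin m → ℝ) (k : Fin K)
    (i j : Fin m) : mleCov lam z k i j = mleCov lam z k j i := by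
  simp only [mleCov, mul_comm (z _ i - _)]

theorem measurable_symm {n : ℕ} : Measurable (symm : (Sym2 (Fin n) → ℝ) → Fin n → Fin n → ℝ) := by
  unfold symm
  fun_prop

end EM

instance measurableAdd₂_prod {X Y : Type*} [MeasurableSpace X] [MeasurableSpace Y] [Add X] [Add Y]
    [MeasurableAdd₂ X] [MeasurableAdd₂ Y] : MeasurableAdd₂ (X × Y) :=
  ⟨((measurable_fst.comp measurable_fst).add (measurable_fst.comp measurable_snd)).prodMk
    ((measurable_snd.comp measurable_fst).add (measurable_snd.comp measurable_snd))⟩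

theorem measurable_map_add_param {Y G : Type*} [MeasurableSpace Y] [MeasurableSpace G] [Add G]
    [MeasurableAdd₂ G] {u : Y → G} (hu : Measurable u) (μ : Measure G) [IsProbabilityMeasure μ] :
    Measurable fun y => μ.map fun e => u y + e :=
  measurable_map_param measurable_const (fun _ => inferInstance) (f := fun y e => u y + e)
    ((hu.comp measurable_fst).add measurable_snd)

/-! ### The three mechanisms -/

/-- The independent noise lives on unordered pairs of indices; filling in the symmetric matrix is
post-processing. -/
theorem dpPCA_eq_map {N d : ℕ} (σ : ℝ) (D : Fin N → Rec d) :
    dpPCA σ D = ((gaussianNoise (Sym2 (Fin d)) σ).map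
      fun e => Sym2.lift ⟨covariance D, covariance_symm D⟩ + e).map symm := by
  rw [Measure.map_map measurable_symm (measurable_const_add _)]
  rfl

theorem renyiBound_dpPCA {N d : ℕ} {α σ : ℝ} (hα : 1 < α) (hσ : 0 < σ) {D D' : Fin N → Rec d}
    (h : Adjacent D D') :
    RenyiBound α (ENNReal.ofReal (Real.exp ((α - 1) * (1 / (2 * σ ^ 2)))))
      (dpPCA σ D) (dpPCA σ D') := by
  rw [dpPCA_eq_map, dpPCA_eq_map]
  exact (renyiBound_gaussianNoise hα hσ _ _ (sum_covariance_sub_sq_le h)).map measurable_symm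

instance isProbabilityMeasure_dpPCA {N d : ℕ} (σ : ℝ) (D : Fin N → Rec d) :
    IsProbabilityMeasure (dpPCA σ D) := by
  rw [dpPCA_eq_map]
  have := Measure.isProbabilityMeasure_map (μ := gaussianNoise (Sym2 (Fin d)) σ)
    (measurable_const_add (Sym2.lift ⟨covariance D, covariance_symm D⟩)).aemeasurable
  exact Measure.isProbabilityMeasure_map measurable_symm.aemeasurable

instance isProbabilityMeasure_gaussianNoise_map_symm (n : ℕ) (σ : ℝ) :
    IsProbabilityMeasure ((gaussianNoise (Sym2 (Fin n)) σ).map symm) :=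
  Measure.isProbabilityMeasure_map measurable_symm.aemeasurable

instance isProbabilityMeasure_emNoise (K m : ℕ) (C : ℝ × ℝ × ℝ) (σ : ℝ) :
    IsProbabilityMeasure (emNoise K m C σ) := by
  unfold emNoise; infer_instance

theorem pi_map_add {ι : Type*} [Fintype ι] {X : ι → Type*} [∀ i, MeasurableSpace (X i)]
    [∀ i, Add (X i)] [∀ i, MeasurableAdd (X i)]
    (μ : ∀ i, Measure (X i)) [∀ i, IsProbabilityMeasure (μ i)] (u : ∀ i, X i) :
    (Measure.pi μ).map (fun e => u + e) = Measure.pi fun i => (μ i).map fun x => u i + x :=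
  Measure.pi_map_pi (f := fun i x => u i + x)
    (hμ := fun i => by
      have := Measure.isProbabilityMeasure_map (μ := μ i) (measurable_const_add (u i)).aemeasurable
      infer_instance)
    fun i => (measurable_const_add (u i)).aemeasurable

theorem RenyiBound.pi_map_add {ι : Type*} [Fintype ι] {X : ι → Type*}
    [∀ i, MeasurableSpace (X i)] [∀ i, Add (X i)] [∀ i, MeasurableAdd (X i)]
    {μ : ∀ i, Measure (X i)} [∀ i, IsProbabilityMeasure (μ i)] {α : ℝ} (hα : 1 < α)
    {K : ι → ℝ≥0∞} {u u' : ∀ i, X i}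
    (h : ∀ i, RenyiBound α (K i) ((μ i).map fun x => u i + x) ((μ i).map fun x => u' i + x)) :
    RenyiBound α (∏ i, K i) ((Measure.pi μ).map fun e => u + e)
      ((Measure.pi μ).map fun e => u' + e) := by
  have := fun (u : ∀ i, X i) i => Measure.isProbabilityMeasure_map (μ := μ i)
    (measurable_const_add (u i)).aemeasurable
  rw [P3GM.pi_map_add, P3GM.pi_map_add]
  exact RenyiBound.pi hα h

theorem RenyiBound.prod_map_add {X Y : Type*} [MeasurableSpace X] [MeasurableSpace Y]
    [Add X] [Add Y] [MeasurableAdd X] [MeasurableAdd Y] {μ : Measure X} {ν : Measure Y}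
    [IsProbabilityMeasure μ] [IsProbabilityMeasure ν] {α : ℝ} (hα : 1 < α) {K K' : ℝ≥0∞}
    {u u' : X} {v v' : Y}
    (h : RenyiBound α K (μ.map fun x => u + x) (μ.map fun x => u' + x))
    (h' : RenyiBound α K' (ν.map fun x => v + x) (ν.map fun x => v' + x)) :
    RenyiBound α (K * K') ((μ.prod ν).map fun e => (u, v) + e)
      ((μ.prod ν).map fun e => (u', v') + e) := by
  have e : ∀ (u : X) (v : Y), (μ.prod ν).map (fun e => (u, v) + e)
      = (μ.map fun x => u + x).prod (ν.map fun x => v + x) := fun u v =>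
    (Measure.map_prod_map μ ν (measurable_const_add u) (measurable_const_add v)).symm
  rw [e, e]
  exact h.prod hα h'

/-- The noise is supported on symmetric matrices, so the shifts must be symmetric too: they are then
images under `symm` of shifts on unordered pairs, where the coordinates of the noise are
independent. -/
theorem renyiBound_gaussianNoise_map_symm {n : ℕ} {α : ℝ} (hα : 1 < α) {σ : ℝ} (hσ : 0 < σ)
    {C : ℝ} {S S' : Fin n × Fin n → ℝ} (hS : ∀ i j, S (i, j) = S (j, i))
    (hS' : ∀ i j, S' (i, j) = S' (j, i)) (hC : l2norm S ≤ C) (hC' : l2norm S' ≤ C) :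
    RenyiBound α (ENNReal.ofReal (Real.exp ((α - 1) * ((2 * C) ^ 2 / (2 * σ ^ 2)))))
      (((gaussianNoise (Sym2 (Fin n)) σ).map symm).map fun e => Function.curry S + e)
      (((gaussianNoise (Sym2 (Fin n)) σ).map symm).map fun e => Function.curry S' + e) := by
  have e : ∀ (S : Fin n × Fin n → ℝ) (hS : ∀ i j, S (i, j) = S (j, i)),
      ((gaussianNoise (Sym2 (Fin n)) σ).map symm).map (fun e => Function.curry S + e)
        = ((gaussianNoise (Sym2 (Fin n)) σ).map fun e =>
          Sym2.lift ⟨fun i j => S (i, j), hS⟩ + e).map symm := by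
    intro S hS
    rw [Measure.map_map measurable_symm (measurable_const_add _),
      Measure.map_map (measurable_const_add _) measurable_symm]
    rfl
  rw [e S hS, e S' hS']
  refine (renyiBound_gaussianNoise hα hσ _ _ ?_).map measurable_symm
  refine (sum_sym2_le _ fun q => sq_nonneg _).trans ?_
  simp only [Sym2.lift_mk]
  rw [← Fintype.sum_prod_type' fun i j => (S (i, j) - S' (i, j)) ^ 2]
  exact sum_sub_sq_le hC hC'

namespace Config

variable {N d m p K L : ℕ} (c : Config N d m p K L)

theorem measurable_enc (hpca : Measurable c.pca) (x : Rec d) :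
    Measurable fun A => c.enc A x := by
  refine measurable_pi_lambda _ fun j => ?_
  simp only [enc, reduce]
  refine Finset.measurable_sum _ fun i _ => ?_
  exact ((measurable_pi_apply j).comp ((measurable_pi_apply i).comp hpca)).mul_const _

/-! #### DP-EM -/

instance isProbabilityMeasure_emStep (a : (Fin d → Fin d → ℝ) × MoG K m) (D : Fin N → Rec d) :
    IsProbabilityMeasure (c.emStep a D) :=
  Measure.isProbabilityMeasure_map (measurable_const_add _).aemeasurable

theorem measurable_emStep (hpca : Measurable c.pca) (D : Fin N → Rec d) :
    Measurable fun a => c.emStep a D := by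
  have h1 : Measurable fun a : (Fin d → Fin d → ℝ) × MoG K m =>
      (a.2, fun n => c.enc a.1 (D n)) :=
    measurable_snd.prodMk (measurable_pi_lambda _ fun n =>
      (c.measurable_enc hpca (D n)).comp measurable_fst)
  have h2 := (measurable_emUpdate (N := N) c.clipEM).comp h1
  simp only [Function.comp_def] at h2
  simp only [emStep]
  exact measurable_map_add_param h2 _

/-- Clipping bounds every block by its radius whatever the data and the current mixture, so any two
datasets give shifts within $2C$ per block. Only finiteness of the constant matters here. -/
theorem exists_renyiBound_emStep {α : ℝ} (hα : 1 < α) (hσe : 0 < c.σe)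
    (hclip : 0 < c.clipEM.1 ∧ 0 < c.clipEM.2.1 ∧ 0 < c.clipEM.2.2) :
    ∃ R : ℝ≥0∞, R ≠ ⊤ ∧ ∀ a D D', RenyiBound α R (c.emStep a D) (c.emStep a D') := by
  obtain ⟨h1, h2, h3⟩ := hclip
  let g : ℝ → ℝ≥0∞ := fun C =>
    ENNReal.ofReal (Real.exp ((α - 1) * ((2 * C) ^ 2 / (2 * (2 * C * c.σe) ^ 2))))
  refine ⟨g c.clipEM.1 * ((∏ _k : Fin K, g c.clipEM.2.1) * ∏ _k : Fin K, g c.clipEM.2.2), ?_,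
    fun a D D' => ?_⟩
  rotate_left
  · refine RenyiBound.prod_map_add hα
      (renyiBound_gaussianNoise hα (by positivity) _ _
        (sum_sub_sq_le (l2norm_clip_le h1 _) (l2norm_clip_le h1 _)))
      (RenyiBound.prod_map_add hα
        (RenyiBound.pi_map_add hα fun k => renyiBound_gaussianNoise hα (by positivity) _ _
          (sum_sub_sq_le (l2norm_clip_le h2 _) (l2norm_clip_le h2 _)))
        (RenyiBound.pi_map_add hα fun k => renyiBound_gaussianNoise_map_symm hα (by positivity)
          ?_ ?_ (l2norm_clip_le h3 _) (l2norm_clip_le h3 _)))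
    all_goals
      intro i j
      -- Clipping rescales all entries of a covariance block alike and so keeps it symmetric.
      simp only [clip, Pi.smul_apply, Function.uncurry_apply_pair]
      rw [mleCov_symm]
  · exact ENNReal.mul_ne_top ENNReal.ofReal_ne_top (ENNReal.mul_ne_top
      (ENNReal.prod_ne_top fun _ _ => ENNReal.ofReal_ne_top)
      (ENNReal.prod_ne_top fun _ _ => ENNReal.ofReal_ne_top))

theorem isProbabilityMeasure_dpEM (hpca : Measurable c.pca) (A : Fin d → Fin d → ℝ)
    (D : Fin N → Rec d) (t : ℕ) : IsProbabilityMeasure (c.dpEM A D t) := by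
  induction t with
  | zero => exact Measure.dirac.isProbabilityMeasure
  | succ t ih =>
    exact isProbabilityMeasure_bind
      ((c.measurable_emStep hpca D).comp measurable_prodMk_left).aemeasurable
      (ae_of_all _ fun _ => inferInstance)

theorem measurable_dpEM (hpca : Measurable c.pca) (D : Fin N → Rec d) (t : ℕ) :
    Measurable fun A => c.dpEM A D t := by
  induction t with
  | zero => exact measurable_const
  | succ t ih =>
    exact measurable_bind_param ih (fun A => c.isProbabilityMeasure_dpEM hpca A D t)
      (c.measurable_emStep hpca D)

theorem renyiBound_dpEM {α : ℝ} (hα : 1 < α) (hpca : Measurable c.pca) {R : ℝ≥0∞}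
    {D D' : Fin N → Rec d} (h : ∀ a, RenyiBound α R (c.emStep a D) (c.emStep a D'))
    (A : Fin d → Fin d → ℝ) (t : ℕ) :
    RenyiBound α (R ^ t) (c.dpEM A D t) (c.dpEM A D' t) := by
  induction t with
  | zero => rw [pow_zero]; exact RenyiBound.refl hα (Measure.dirac _)
  | succ t ih =>
    rw [pow_succ]
    exact ih.bind hα ((c.measurable_emStep hpca D).comp measurable_prodMk_left)
      ((c.measurable_emStep hpca D').comp measurable_prodMk_left) fun lam => h (A, lam)

/-! #### DP-SGD -/

/-- The sum of the clipped gradients over a batch, as a function of the auxiliary input and the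
Monte Carlo samples. -/
noncomputable def clippedSum (S : Finset (Fin N)) (D : Fin N → Rec d)
    (a : (Fin d → Fin d → ℝ) × MoG K m × (Fin p → ℝ)) (ξ : Fin N → Fin L → Fin m → ℝ) :
    Fin p → ℝ :=
  ∑ b ∈ S, clip c.C (c.elboGrad a.2.2 (D b).1 (c.enc a.1 (D b)) a.2.1 (ξ b))

/-- The law of the Monte Carlo samples of one step of DP-SGD. -/
noncomputable def sampleLaw (N L m : ℕ) : Measure (Fin N → Fin L → Fin m → ℝ) :=
  Measure.pi fun _ : Fin N => Measure.pi fun _ : Fin L => gaussianNoise (Fin m) 1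

instance isProbabilityMeasure_sampleLaw : IsProbabilityMeasure (sampleLaw N L m) := by
  unfold sampleLaw; infer_instance

theorem sgdStep_eq (a : (Fin d → Fin d → ℝ) × MoG K m × (Fin p → ℝ)) (D : Fin N → Rec d) :
    c.sgdStep a D = ∑ S : Finset (Fin N), c.batch S •
      ((sampleLaw N L m).prod (gaussianNoise (Fin p) (c.σs * c.C))).map fun w =>
        (c.B : ℝ)⁻¹ • (c.clippedSum S D a w.1 + w.2) := rfl

/-- The gradient is jointly measurable in all its arguments. -/
abbrev MeasurableGrad : Prop :=
  Measurable fun q : (Fin p → ℝ) × (Fin d → ℝ) × (Fin m → ℝ) × MoG K m ×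
    (Fin L → Fin m → ℝ) => c.elboGrad q.1 q.2.1 q.2.2.1 q.2.2.2.1 q.2.2.2.2

theorem measurable_clippedSum (hpca : Measurable c.pca) (hgrad : c.MeasurableGrad)
    (S : Finset (Fin N)) (D : Fin N → Rec d) :
    Measurable fun r : ((Fin d → Fin d → ℝ) × MoG K m × (Fin p → ℝ)) ×
      (Fin N → Fin L → Fin m → ℝ) => c.clippedSum S D r.1 r.2 := by
  refine Finset.measurable_sum _ fun b _ => (measurable_clip c.C).comp ?_
  have h : Measurable fun r : ((Fin d → Fin d → ℝ) × MoG K m × (Fin p → ℝ)) ×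
      (Fin N → Fin L → Fin m → ℝ) =>
      (r.1.2.2, (D b).1, c.enc r.1.1 (D b), r.1.2.1, r.2 b) :=
    (measurable_snd.comp (measurable_snd.comp measurable_fst)).prodMk
      (measurable_const.prodMk
        (((c.measurable_enc hpca (D b)).comp (measurable_fst.comp measurable_fst)).prodMk
          ((measurable_fst.comp (measurable_snd.comp measurable_fst)).prodMk
            ((measurable_pi_apply b).comp measurable_snd))))
  have h' := hgrad.comp h
  simp only [Function.comp_def] at h'
  exact h'

theorem l2norm_clippedSum_le (hC : 0 < c.C) (S : Finset (Fin N)) (D : Fin N → Rec d)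
    (a : (Fin d → Fin d → ℝ) × MoG K m × (Fin p → ℝ)) (ξ : Fin N → Fin L → Fin m → ℝ) :
    l2norm (c.clippedSum S D a ξ) ≤ N * c.C := by
  rw [l2norm, clippedSum, WithLp.toLp_sum]
  calc _ ≤ ∑ _b ∈ S, c.C := norm_sum_le_of_le _ fun b _ => l2norm_clip_le hC _
    _ = S.card * c.C := by rw [Finset.sum_const, nsmul_eq_mul]
    _ ≤ N * c.C := by
        gcongr
        simpa using Finset.card_le_univ S

theorem sum_batch : ∑ S : Finset (Fin N), c.batch S = 1 := by
  rw [← tsum_fintype (L := .unconditional _)]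
  exact c.batch.tsum_coe

theorem measurable_sgd_output (hpca : Measurable c.pca) (hgrad : c.MeasurableGrad)
    (S : Finset (Fin N)) (D : Fin N → Rec d) :
    Measurable fun r : ((Fin d → Fin d → ℝ) × MoG K m × (Fin p → ℝ)) ×
      ((Fin N → Fin L → Fin m → ℝ) × (Fin p → ℝ)) =>
        (c.B : ℝ)⁻¹ • (c.clippedSum S D r.1 r.2.1 + r.2.2) := by
  have h : Measurable fun r : ((Fin d → Fin d → ℝ) × MoG K m × (Fin p → ℝ)) ×
      ((Fin N → Fin L → Fin m → ℝ) × (Fin p → ℝ)) => (r.1, r.2.1) :=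
    measurable_fst.prodMk (measurable_fst.comp measurable_snd)
  have h' := (c.measurable_clippedSum hpca hgrad S D).comp h
  simp only [Function.comp_def] at h'
  exact (measurable_const_smul (c.B : ℝ)⁻¹).comp (h'.add (measurable_snd.comp measurable_snd))

theorem measurable_sgdStep (hpca : Measurable c.pca) (hgrad : c.MeasurableGrad)
    (D : Fin N → Rec d) : Measurable fun a => c.sgdStep a D := by
  simp only [sgdStep_eq]
  refine measurable_sum_smul _ _ fun S => ?_
  exact measurable_map_param
    (κ := fun _ => (sampleLaw N L m).prod (gaussianNoise (Fin p) (c.σs * c.C))) measurable_const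
    (fun _ => inferInstance) (f := fun a w => (c.B : ℝ)⁻¹ • (c.clippedSum S D a w.1 + w.2))
    (c.measurable_sgd_output hpca hgrad S D)

theorem isProbabilityMeasure_sgdStep (hpca : Measurable c.pca) (hgrad : c.MeasurableGrad)
    (a : (Fin d → Fin d → ℝ) × MoG K m × (Fin p → ℝ))
    (D : Fin N → Rec d) : IsProbabilityMeasure (c.sgdStep a D) := by
  refine ⟨?_⟩
  have h := fun S => Measure.isProbabilityMeasure_map
    (μ := (sampleLaw N L m).prod (gaussianNoise (Fin p) (c.σs * c.C)))
    ((c.measurable_sgd_output hpca hgrad S D).comp (measurable_prodMk_left (x := a))).aemeasurable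
  rw [sgdStep_eq]
  simp only [Measure.coe_finsetSum, Finset.sum_apply, Measure.smul_apply, smul_eq_mul]
  rw [← c.sum_batch]
  refine Finset.sum_congr rfl fun S _ => ?_
  exact (congrArg _ (h S).measure_univ).trans (mul_one _)

/-- Once the batch and the Monte Carlo samples are fixed, the step is a Gaussian shift by a vector
of norm at most $NC$. Both are drawn from the same law for the two datasets, so averaging over them
costs nothing. The crude radius is enough because only finiteness is claimed. -/
theorem exists_renyiBound_sgdStep (hpca : Measurable c.pca) (hgrad : c.MeasurableGrad)
    {α : ℝ} (hα : 1 < α) (hσs : 0 < c.σs) (hC : 0 < c.C) :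
    ∃ R : ℝ≥0∞, R ≠ ⊤ ∧ ∀ a D D', RenyiBound α R (c.sgdStep a D) (c.sgdStep a D') := by
  refine ⟨1 * ENNReal.ofReal (Real.exp ((α - 1) *
    ((2 * (N * c.C)) ^ 2 / (2 * (c.σs * c.C) ^ 2)))),
    ENNReal.mul_ne_top ENNReal.one_ne_top ENNReal.ofReal_ne_top, fun a D D' => ?_⟩
  rw [sgdStep_eq, sgdStep_eq]
  refine RenyiBound.sum hα c.sum_batch fun S _ => ?_
  have hm : ∀ D : Fin N → Rec d, Measurable fun r : (Fin N → Fin L → Fin m → ℝ) × (Fin p → ℝ) =>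
      c.clippedSum S D a r.1 + r.2 := fun D =>
    ((c.measurable_clippedSum hpca hgrad S D).comp
      (measurable_const.prodMk measurable_fst)).add measurable_snd
  have hk : ∀ D : Fin N → Rec d, Measurable fun ξ => (gaussianNoise (Fin p) (c.σs * c.C)).map
      fun e => c.clippedSum S D a ξ + e := fun D =>
    measurable_map_add_param ((c.measurable_clippedSum hpca hgrad S D).comp
      measurable_prodMk_left) _
  have e : ∀ D : Fin N → Rec d,
      ((sampleLaw N L m).prod (gaussianNoise (Fin p) (c.σs * c.C))).map
        (fun w => (c.B : ℝ)⁻¹ • (c.clippedSum S D a w.1 + w.2))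
      = ((sampleLaw N L m).bind fun ξ => (gaussianNoise (Fin p) (c.σs * c.C)).map
          fun e => c.clippedSum S D a ξ + e).map fun g => (c.B : ℝ)⁻¹ • g := by
    intro D
    rw [← prod_map_eq_bind _ _ (hm D) (hk D), Measure.map_map (measurable_const_smul _) (hm D)]
    rfl
  rw [e, e]
  refine RenyiBound.map ?_ (measurable_const_smul _)
  -- The sample law is compared with itself, which is the factor 1 in the constant.
  refine (RenyiBound.refl hα _).bind hα (hk D) (hk D') fun ξ => ?_
  exact renyiBound_gaussianNoise hα (by positivity) _ _
    (sum_sub_sq_le (c.l2norm_clippedSum_le hC S D a ξ) (c.l2norm_clippedSum_le hC S D' a ξ))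

theorem measurable_sgd_update (hpca : Measurable c.pca) (hgrad : c.MeasurableGrad)
    (D : Fin N → Rec d) (t : ℕ) :
    Measurable fun r : ((Fin d → Fin d → ℝ) × MoG K m) × (Fin p → ℝ) =>
      (c.sgdStep (r.1.1, r.1.2, r.2) D).map fun g => r.2 - c.η t • g := by
  have h : Measurable fun r : ((Fin d → Fin d → ℝ) × MoG K m) × (Fin p → ℝ) =>
      (r.1.1, r.1.2, r.2) :=
    (measurable_fst.comp measurable_fst).prodMk
      ((measurable_snd.comp measurable_fst).prodMk measurable_snd)
  refine measurable_map_param (κ := fun r => c.sgdStep (r.1.1, r.1.2, r.2) D)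
    ((c.measurable_sgdStep hpca hgrad D).comp h)
    (fun r => c.isProbabilityMeasure_sgdStep hpca hgrad _ D)
    (f := fun (r : ((Fin d → Fin d → ℝ) × MoG K m) × (Fin p → ℝ)) g => r.2 - c.η t • g) ?_
  exact (measurable_snd.comp measurable_fst).sub
    ((measurable_const_smul (c.η t)).comp measurable_snd)

theorem isProbabilityMeasure_dpSGD (hpca : Measurable c.pca) (hgrad : c.MeasurableGrad)
    (A : Fin d → Fin d → ℝ) (lam : MoG K m)
    (D : Fin N → Rec d) (t : ℕ) : IsProbabilityMeasure (c.dpSGD A lam D t) := by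
  induction t with
  | zero => exact Measure.dirac.isProbabilityMeasure
  | succ t ih =>
    refine isProbabilityMeasure_bind ((c.measurable_sgd_update hpca hgrad D t).comp
      (measurable_prodMk_left (x := (A, lam)))).aemeasurable (ae_of_all _ fun θ => ?_)
    have := c.isProbabilityMeasure_sgdStep hpca hgrad (A, lam, θ) D
    exact Measure.isProbabilityMeasure_map
      ((measurable_const_smul (c.η t)).const_sub θ).aemeasurable

theorem measurable_dpSGD (hpca : Measurable c.pca) (hgrad : c.MeasurableGrad)
    (D : Fin N → Rec d) (t : ℕ) :
    Measurable fun r : (Fin d → Fin d → ℝ) × MoG K m => c.dpSGD r.1 r.2 D t := by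
  induction t with
  | zero => exact measurable_const
  | succ t ih =>
    exact measurable_bind_param ih
      (fun r => c.isProbabilityMeasure_dpSGD hpca hgrad r.1 r.2 D t)
      (c.measurable_sgd_update hpca hgrad D t)

theorem renyiBound_dpSGD (hpca : Measurable c.pca) (hgrad : c.MeasurableGrad)
    {α : ℝ} (hα : 1 < α) {R : ℝ≥0∞}
    {D D' : Fin N → Rec d} (h : ∀ a, RenyiBound α R (c.sgdStep a D) (c.sgdStep a D'))
    (A : Fin d → Fin d → ℝ) (lam : MoG K m) (t : ℕ) :
    RenyiBound α (R ^ t) (c.dpSGD A lam D t) (c.dpSGD A lam D' t) := by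
  induction t with
  | zero => rw [pow_zero]; exact RenyiBound.refl hα (Measure.dirac _)
  | succ t ih =>
    rw [pow_succ]
    exact ih.bind hα
      ((c.measurable_sgd_update hpca hgrad D t).comp (measurable_prodMk_left (x := (A, lam))))
      ((c.measurable_sgd_update hpca hgrad D' t).comp (measurable_prodMk_left (x := (A, lam))))
      fun θ => (h (A, lam, θ)).map ((measurable_const_smul (c.η t)).const_sub θ)

/-! #### The pipeline -/

theorem measurable_dpSGD_map (hpca : Measurable c.pca) (hgrad : c.MeasurableGrad)
    (D : Fin N → Rec d) (t : ℕ) :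
    Measurable fun r : (Fin d → Fin d → ℝ) × MoG K m =>
      (c.dpSGD r.1 r.2 D t).map fun θ => (θ, r.2) :=
  measurable_map_param (c.measurable_dpSGD hpca hgrad D t)
    (fun r => c.isProbabilityMeasure_dpSGD hpca hgrad r.1 r.2 D t) (f := fun r θ => (θ, r.2))
    (measurable_snd.prodMk (measurable_snd.comp measurable_fst))

theorem measurable_dpEM_bind_dpSGD (hpca : Measurable c.pca) (hgrad : c.MeasurableGrad)
    (D : Fin N → Rec d) (Te Ts : ℕ) :
    Measurable fun A => (c.dpEM A D Te).bind fun lam =>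
      (c.dpSGD A lam D Ts).map fun θ => (θ, lam) :=
  measurable_bind_param (c.measurable_dpEM hpca D Te)
    (fun A => c.isProbabilityMeasure_dpEM hpca A D Te) (c.measurable_dpSGD_map hpca hgrad D Ts)

theorem isProbabilityMeasure_p3gm (hpca : Measurable c.pca) (hgrad : c.MeasurableGrad)
    (Te Ts : ℕ) (D : Fin N → Rec d) :
    IsProbabilityMeasure (c.p3gm Te Ts D) := by
  refine isProbabilityMeasure_bind
    (c.measurable_dpEM_bind_dpSGD hpca hgrad D Te Ts).aemeasurable (ae_of_all _ fun A => ?_)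
  have := c.isProbabilityMeasure_dpEM hpca A D Te
  refine isProbabilityMeasure_bind
    ((c.measurable_dpSGD_map hpca hgrad D Ts).comp measurable_prodMk_left).aemeasurable
    (ae_of_all _ fun lam => ?_)
  have := c.isProbabilityMeasure_dpSGD hpca hgrad A lam D Ts
  exact Measure.isProbabilityMeasure_map measurable_prodMk_right.aemeasurable

/-- Both datasets are compared at the same released matrix and mixture. Attaching the mixture to the
final network parameters is post-processing. -/
theorem renyiBound_p3gm (hpca : Measurable c.pca) (hgrad : c.MeasurableGrad)
    {α : ℝ} (hα : 1 < α) (hσp : 0 < c.σp) {Re Rs : ℝ≥0∞}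
    {D D' : Fin N → Rec d} (hD : Adjacent D D')
    (he : ∀ a, RenyiBound α Re (c.emStep a D) (c.emStep a D'))
    (hs : ∀ a, RenyiBound α Rs (c.sgdStep a D) (c.sgdStep a D')) (Te Ts : ℕ) :
    RenyiBound α (ENNReal.ofReal (Real.exp ((α - 1) * (1 / (2 * c.σp ^ 2)))) *
      (Re ^ Te * Rs ^ Ts)) (c.p3gm Te Ts D) (c.p3gm Te Ts D') :=
  (renyiBound_dpPCA hα hσp hD).bind hα (c.measurable_dpEM_bind_dpSGD hpca hgrad D Te Ts)
    (c.measurable_dpEM_bind_dpSGD hpca hgrad D' Te Ts) fun A =>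
      (c.renyiBound_dpEM hα hpca he A Te).bind hα
        ((c.measurable_dpSGD_map hpca hgrad D Ts).comp measurable_prodMk_left)
        ((c.measurable_dpSGD_map hpca hgrad D' Ts).comp measurable_prodMk_left) fun lam =>
          (c.renyiBound_dpSGD hpca hgrad hα hs A lam Ts).map measurable_prodMk_right

end Config

end P3GM

/-! ### Assembly of the privacy guarantee -/

theorem theorem4 {N d m p K L : ℕ} (c : P3GM.Config N d m p K L)
    (hσp : 0 < c.σp) (hσe : 0 < c.σe) (hσs : 0 < c.σs)
    (hpca : Measurable c.pca)
    (hpca' : ∀ S : Fin d → Fin d → ℝ, (Matrix.of S).IsSymm →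
      P3GM.IsPrincipal (Matrix.of S) (Matrix.of (c.pca S)))
    (hclip : 0 < c.clipEM.1 ∧ 0 < c.clipEM.2.1 ∧ 0 < c.clipEM.2.2)
    (hC : 0 < c.C)
    (hB : 0 < c.B) (hBN : c.B ≤ N)
    (hbatch : ∀ i : Fin N, ∑ S : Finset (Fin N) with i ∈ S, c.batch S = (c.B : ℝ≥0∞) / N)
    (hgrad : Measurable fun q : (Fin p → ℝ) × (Fin d → ℝ) × (Fin m → ℝ) × P3GM.MoG K m ×
      (Fin L → Fin m → ℝ) => c.elboGrad q.1 q.2.1 q.2.2.1 q.2.2.2.1 q.2.2.2.2)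
    (Te Ts : ℕ) (α δ : ℝ) (hα : 1 < α) (hδ : 0 < δ) (hδ' : δ < 1) :
    (∀ D, IsProbabilityMeasure (c.p3gm Te Ts D)) ∧
    P3GM.MA c.emStep (α - 1) ≠ ⊤ ∧ P3GM.MA c.sgdStep (α - 1) ≠ ⊤ ∧
    P3GM.IsDP (c.p3gm Te Ts)
      (α / (2 * c.σp ^ 2)
        + Ts * ((P3GM.MA c.sgdStep (α - 1)).toReal / (α - 1))
        + Te * ((P3GM.MA c.emStep (α - 1)).toReal / (α - 1))
        + Real.log (1 / δ) / (α - 1)) δ := by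
  have hpe := fun a D => P3GM.Config.isProbabilityMeasure_emStep c a D
  have hps := fun a D => P3GM.Config.isProbabilityMeasure_sgdStep c hpca hgrad a D
  have hpp := fun D => P3GM.Config.isProbabilityMeasure_p3gm c hpca hgrad Te Ts D
  obtain ⟨Re, hRe, he⟩ := c.exists_renyiBound_emStep hα hσe hclip
  obtain ⟨Rs, hRs, hs⟩ := c.exists_renyiBound_sgdStep hpca hgrad hα hσs hC
  have hMe := P3GM.MA_ne_top hα hpe hRe he
  have hMs := P3GM.MA_ne_top hα hps hRs hs
  refine ⟨hpp, hMe, hMs, fun D D' hD S hS => ?_⟩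
  refine P3GM.RenyiBound.apply_le_exp_mul_add hα hδ ?_ hS
  have h := c.renyiBound_p3gm hpca hgrad hα hσp hD
    (fun a => P3GM.renyiBound_of_MA hα hpe hMe a hD)
    (fun a => P3GM.renyiBound_of_MA hα hps hMs a hD) Te Ts
  -- The factor $(\alpha-1)/\alpha$ turns $\alpha/(2\sigma_p^2)$ into the exponent
  -- $(\alpha-1)/(2\sigma_p^2)$ of DP-PCA, and each $MA/(\alpha-1)$ into the exponent $MA/\alpha$ of
  -- one step.
  convert h using 1
  have h0 : α ≠ 0 := by linarith
  have h1 : α - 1 ≠ 0 := by linarith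
  rw [← ENNReal.ofReal_pow (Real.exp_nonneg _), ← ENNReal.ofReal_pow (Real.exp_nonneg _),
    ← Real.exp_nat_mul, ← Real.exp_nat_mul, ← ENNReal.ofReal_mul (Real.exp_nonneg _),
    ← ENNReal.ofReal_mul (Real.exp_nonneg _), ← Real.exp_add, ← Real.exp_add]
  congr 2
  field_simp
  ring
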